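/- Let $J_0(x)=\sum_{k\ge 0}\frac{(-1)^k (x/2)^{2k}}{k!^2}$ be the Bessel function and $I_0(x)=\sum_{k\ge 0}\frac{(x/2)^{2k}}{k!^2}$ the modified Bessel function of order zero. For $j\ge 0$ put $W_j(z)=\frac{d^{2j}}{dt^{2j}}\left[e^{-t^2}I_0(2tz)\right]_{t=0}$. Then each $W_j$ is a polynomial and, for all real $t,z$, $$e^{-t^2}I_0(2tz)=\sum_{j=0}^\infty \frac{t^{2j}}{(2j)!}W_j(z).$$ Let $\beta>0$, $c>0$, and let $f:[0,\infty)\to\mathbb R$ be measurable with $\int_0^\infty |f(\xi)|\,e^{c\xi^2}\,\xi\,d\xi<\infty$. For $\tau>0$ and $r\ge 0$ let $$u(\tau,r)=\int_0^\infty \lambda e^{-\lambda^2\tau}J_0(\lambda r)\left(\int_0^\infty \xi J_0(\lambda\xi)f(\xi)\,d\xi\right)d\lambda .$$ Then $u$ solves the Cauchy problem for the heat equation in polar coordinates with radially symmetric initial datum $f$: it is continuous on $(0,\infty)\times[0,\infty)$; for $\tau>0$, $r>0$ the derivatives $u_\tau,u_r,u_{rr}$ exist and $u_\tau=u_{rr}+\frac1r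 u_r$; $u_r(\tau,0)=0$ for $\tau>0$ (one-sided derivative); and $u(\tau,\rho)\to f(r)$ as $\tau\to0^+$, $\rho\to r$, $\rho\ge 0$, at every point $r\ge 0$ at which $f$ is continuous. Moreover the integrals $$f_j=\int_0^\infty W_j\!\left(\frac{\xi}{2\sqrt\beta}\right)\xi f(\xi)\,d\xi\qquad(j\ge 0)$$ converge absolutely, and for every $\tau>0$ with $c>\frac{1}{4(\tau+2\beta)}$ (in particular for every $\tau>0$ if $c\ge\frac1{8\beta}$) and every $r\ge0$ $$u(\tau,r)=\frac{e^{-\frac{r^2}{4(\tau+\beta)}}}{2(\tau+\beta)}\sum_{j=0}^\infty \frac{1}{(\tau+\beta)^j}\,W_j\!\left(\frac{r}{2\sqrt{\tau+\beta}}\right)\frac{j!^2\,\beta^j}{(2j)!^2}\,f_j ,$$ where the series converges absolutely. -/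

import Mathlib

open Real Set Filter Topology MeasureTheory

noncomputable section

/-- The Bessel function of order zero, `J₀(x) = ∑ (-1)^k (x/2)^(2k) / (k!)²`. -/
def besselJ0 (x : ℝ) : ℝ :=
  ∑' k : ℕ, (-1) ^ k * (x / 2) ^ (2 * k) / (k.factorial : ℝ) ^ 2

/-- The modified Bessel function of order zero, `I₀(x) = ∑ (x/2)^(2k) / (k!)²`. -/
def besselI0 (x : ℝ) : ℝ :=
  ∑' k : ℕ, (x / 2) ^ (2 * k) / (k.factorial : ℝ) ^ 2

/-- The polynomial `W_j(z)`, the Taylor coefficient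
`d^{2j}/dt^{2j} [exp(-t²) I₀(2tz)]` at `t = 0` of the generating function. -/
def radialW (j : ℕ) (z : ℝ) : ℝ :=
  iteratedDeriv (2 * j) (fun t : ℝ => exp (-t ^ 2) * besselI0 (2 * t * z)) 0

/-- The Hankel transform of order zero, `∫_0^∞ ξ J₀(λξ) f(ξ) dξ`. -/
def hankelTransform (f : ℝ → ℝ) (l : ℝ) : ℝ :=
  ∫ ξ in Ioi (0 : ℝ), ξ * besselJ0 (l * ξ) * f ξ

/-- The explicit (Fourier-Bessel) solution of the radial Cauchy problem with initial datum `f`: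
`u(τ, r) = ∫_0^∞ λ exp(-λ² τ) J₀(λ r) (∫_0^∞ ξ J₀(λ ξ) f(ξ) dξ) dλ`. -/
def radialHeat (f : ℝ → ℝ) (τ r : ℝ) : ℝ :=
  ∫ l in Ioi (0 : ℝ), l * exp (-l ^ 2 * τ) * besselJ0 (l * r) * hankelTransform f l

/-- `u` solves the Cauchy problem for the heat equation in the plane, in polar coordinates and
for data that depend only on the radius: `u_τ = u_rr + u_r / r` for `τ > 0`, `r > 0`, with
regularity at the pole `r = 0` and initial value `f` (attained wherever `f` is continuous). -/
structure IsRadialHeatSolution (f : ℝ → ℝ) (u : ℝ → ℝ → ℝ) : Prop where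
  continuousOn : ContinuousOn (fun p : ℝ × ℝ => u p.1 p.2) (Ioi 0 ×ˢ Ici 0)
  differentiable_time : ∀ τ > 0, ∀ r > 0, DifferentiableAt ℝ (fun t => u t r) τ
  differentiable_radius : ∀ τ > 0, ∀ r > 0, DifferentiableAt ℝ (u τ) r
  differentiable_radius_two : ∀ τ > 0, ∀ r > 0, DifferentiableAt ℝ (deriv (u τ)) r
  heat_equation : ∀ τ > 0, ∀ r > 0,
    deriv (fun t => u t r) τ = deriv (deriv (u τ)) r + (1 / r) * deriv (u τ) r
  regular_at_pole : ∀ τ > 0, HasDerivWithinAt (u τ) 0 (Ici 0) 0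
  initial_value : ∀ r ≥ 0, ContinuousWithinAt f (Ici 0) r →
    Tendsto (fun p : ℝ × ℝ => u p.1 p.2) (𝓝[>] 0 ×ˢ 𝓝[≥] r) (𝓝 (f r))

/-- The coefficient `f_j = ∫_0^∞ W_j(ξ / (2√β)) ξ f(ξ) dξ`. -/
def radialCoeff (β : ℝ) (f : ℝ → ℝ) (j : ℕ) : ℝ :=
  ∫ ξ in Ioi (0 : ℝ), radialW j (ξ / (2 * √β)) * (ξ * f ξ)

end

/-! The polynomials are Laguerre polynomials in disguise: comparing Taylor coefficients gives W_j(z)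
= (-1)^j (2j)!/j! L_j(z²), since ∑ s^j/j! L_j(y) = e^s ∑ (-sy)^k/(k!)²
(`hasSum_laguerre_div_factorial`). Taking s = λ²β and y = ξ²/(4β) in this series expands e^{λ²β}
J₀(λξ) with the variables separated. In the double integral for u write e^{-λ²τ} = e^{-λ²(τ+β)}
e^{λ²β}, insert the series and integrate termwise. The λ-integral is again a Laguerre function
(`integral_pow_mul_exp_mul_besselJ0`, by Kummer's transformation), and the ξ-integral is f_j up to a
constant.

The interchange rests on `abs_laguerre_mul_pow_le`, Cauchy's estimate for the ordinary generating
function on |t| = q: L_j grows at most like q^{-j} exp(y q/(1+q)). The weight e^{cξ²} absorbs the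
exponential, and the remaining series is geometric with ratio β/((τ+β)q). The requirements q >
β/(τ+β) and q/(1+q) ≤ 4βc are compatible when c > 1/(4(τ+2β)).

For the Cauchy problem, Poisson's integral bounds J₀, J₀' and J₀'' by 1, so the Gaussian factor
permits differentiation under the integral and Bessel's equation becomes the heat equation. Weber's
integral rewrites u as an average of f against a positive kernel of mass one, concentrated near ξ =
ρ, which yields the initial values. -/

/-! ### Laguerre polynomials and Bessel power series -/

/-- The Laguerre polynomial `L_n(y) = ∑ (n choose k) (-y)^k / k!`. -/
noncomputable def laguerre (n : ℕ) (y : ℝ) : ℝ :=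
  ∑ k ∈ Finset.range (n + 1), (n.choose k : ℝ) * (-y) ^ k / (k.factorial : ℝ)

/-- The entire function `∑ x^k / (k!)²` underlying the Bessel functions of order zero. -/
noncomputable def besselSeries (x : ℝ) : ℝ :=
  ∑' k : ℕ, x ^ k / (k.factorial : ℝ) ^ 2

lemma summable_norm_pow_div_factorial (x : ℝ) :
    Summable fun k : ℕ => ‖x ^ k / (k.factorial : ℝ)‖ :=
  (Real.summable_pow_div_factorial x).norm

lemma summable_norm_besselSeries (x : ℝ) :
    Summable fun k : ℕ => ‖x ^ k / (k.factorial : ℝ) ^ 2‖ := by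
  refine Summable.of_nonneg_of_le (fun _ => norm_nonneg _) (fun k => ?_)
    (summable_norm_pow_div_factorial x)
  have h1 : (1 : ℝ) ≤ k.factorial := by exact_mod_cast k.factorial_pos
  rw [norm_div, norm_div]
  refine div_le_div_of_nonneg_left (norm_nonneg _)
    (norm_pos_iff.mpr (by positivity)) ?_
  rw [Real.norm_of_nonneg (by positivity), Real.norm_of_nonneg (by positivity)]
  nlinarith

lemma hasSum_besselSeries (x : ℝ) :
    HasSum (fun k : ℕ => x ^ k / (k.factorial : ℝ) ^ 2) (besselSeries x) :=
  (summable_norm_besselSeries x).of_norm.hasSum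

lemma besselI0_eq_besselSeries (x : ℝ) : besselI0 x = besselSeries (x ^ 2 / 4) := by
  unfold besselI0 besselSeries
  congr 1; ext k
  rw [pow_mul]; congr 2; ring

lemma besselJ0_eq_besselSeries (x : ℝ) : besselJ0 x = besselSeries (-(x ^ 2 / 4)) := by
  unfold besselJ0 besselSeries
  congr 1; ext k
  rw [pow_mul, neg_eq_neg_one_mul (x ^ 2 / 4), mul_pow]; congr 3; ring

lemma hasSum_exp_series (x : ℝ) : HasSum (fun k : ℕ => x ^ k / (k.factorial : ℝ)) (exp x) := by
  rw [Real.exp_eq_exp_ℝ]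
  exact NormedSpace.expSeries_div_hasSum_exp x

/-- The exponential generating function of the Laguerre polynomials. -/
lemma hasSum_laguerre_div_factorial (s y : ℝ) :
    HasSum (fun j : ℕ => s ^ j / (j.factorial : ℝ) * laguerre j y)
      (exp s * besselSeries (-(s * y))) := by
  have hf := summable_norm_besselSeries (-(s * y))
  have hg := summable_norm_pow_div_factorial s
  -- Cauchy product of the Bessel series with the exponential series; each antidiagonal sum is one
  -- Laguerre polynomial.
  have key := tsum_mul_tsum_eq_tsum_sum_antidiagonal_of_summable_norm hf hg
  rw [(hasSum_exp_series s).tsum_eq, (hasSum_besselSeries _).tsum_eq, mul_comm] at key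
  have hs := (summable_norm_sum_mul_antidiagonal_of_summable_norm hf hg).of_norm.hasSum
  rw [← key] at hs
  convert! hs using 2 with j
  rw [Finset.Nat.sum_antidiagonal_eq_sum_range_succ
    (fun k m => (-(s * y)) ^ k / (k.factorial : ℝ) ^ 2 * (s ^ m / (m.factorial : ℝ))), laguerre,
    Finset.mul_sum]
  refine Finset.sum_congr rfl fun k hk => ?_
  have hk' : k ≤ j := Nat.lt_succ_iff.mp (Finset.mem_range.mp hk)
  rw [Nat.cast_choose ℝ hk']
  have h1 : (k.factorial : ℝ) ≠ 0 := by positivity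
  have h2 : (j.factorial : ℝ) ≠ 0 := by positivity
  have h3 : ((j - k).factorial : ℝ) ≠ 0 := by positivity
  have h4 : s ^ j = s ^ k * s ^ (j - k) := by rw [← pow_add]; congr 1; omega
  rw [h4, neg_mul_eq_mul_neg, mul_pow]
  field_simp

/-- Kummer's transformation for Laguerre polynomials. -/
lemma hasSum_choose_mul_pow_div_factorial (j : ℕ) (x : ℝ) :
    HasSum (fun n : ℕ => ((j + n).choose n : ℝ) * (-x) ^ n / (n.factorial : ℝ))
      (exp (-x) * laguerre j x) := by
  have hf : HasSum (fun k : ℕ => (j.choose k : ℝ) * (-x) ^ k / (k.factorial : ℝ))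
      (laguerre j x) := by
    refine hasSum_sum_of_ne_finset_zero fun k hk => ?_
    rw [Nat.choose_eq_zero_of_lt (by simpa using hk)]; simp
  have hfn : Summable fun k : ℕ => ‖(j.choose k : ℝ) * (-x) ^ k / (k.factorial : ℝ)‖ :=
    hf.summable.norm
  have hg := summable_norm_pow_div_factorial (-x)
  have key := tsum_mul_tsum_eq_tsum_sum_antidiagonal_of_summable_norm hfn hg
  rw [(hasSum_exp_series _).tsum_eq, hf.tsum_eq, mul_comm] at key
  have hs := (summable_norm_sum_mul_antidiagonal_of_summable_norm hfn hg).of_norm.hasSum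
  rw [← key] at hs
  convert! hs using 2 with n
  -- Vandermonde's identity splits the binomial coefficient along the antidiagonal of the Cauchy
  -- product.
  rw [Nat.add_choose_eq, Nat.cast_sum, Finset.sum_mul, Finset.sum_div]
  refine Finset.sum_congr rfl fun p hp => ?_
  obtain ⟨a, b⟩ := p
  obtain rfl : a + b = n := Finset.HasAntidiagonal.mem_antidiagonal.mp hp
  have hc : ((a + b).choose b : ℝ) = ((a + b).factorial : ℝ) / (a.factorial * b.factorial) := by
    rw [Nat.cast_choose ℝ (Nat.le_add_left b a), Nat.add_sub_cancel, mul_comm]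
  have h1 : (a.factorial : ℝ) ≠ 0 := by positivity
  have h2 : (b.factorial : ℝ) ≠ 0 := by positivity
  have h3 : ((a + b).factorial : ℝ) ≠ 0 := by positivity
  rw [Nat.cast_mul, hc, pow_add]
  field_simp

/-- Uniqueness of power series coefficients. The field is left general because the real case
identifies `radialW` and the complex case feeds Cauchy's estimate. -/
lemma iteratedDeriv_zero_of_hasSum {𝕜 : Type*} [RCLike 𝕜] {f : 𝕜 → 𝕜} {a : ℕ → 𝕜}
    (h : ∀ᶠ t in 𝓝 (0 : 𝕜), HasSum (fun n : ℕ => t ^ n * a n) (f t)) (n : ℕ) :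
    iteratedDeriv n f 0 = (n.factorial : 𝕜) * a n := by
  have hp : HasFPowerSeriesAt f (FormalMultilinearSeries.ofScalars 𝕜 a) 0 := by
    rw [hasFPowerSeriesAt_iff]
    filter_upwards [h] with t ht
    simpa [FormalMultilinearSeries.coeff_ofScalars] using ht
  have := congrArg (fun p => FormalMultilinearSeries.coeff p n)
    (hp.eq_formalMultilinearSeries (AnalyticAt.hasFPowerSeriesAt ⟨_, hp⟩))
  simp only [FormalMultilinearSeries.coeff_ofScalars] at this
  rw [this, mul_div_cancel₀]
  exact_mod_cast n.factorial_ne_zero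

lemma hasSum_genFun_laguerre (t z : ℝ) :
    HasSum (fun j : ℕ => t ^ (2 * j) * ((-1) ^ j / (j.factorial : ℝ) * laguerre j (z ^ 2)))
      (exp (-t ^ 2) * besselI0 (2 * t * z)) := by
  have h := hasSum_laguerre_div_factorial (-t ^ 2) (z ^ 2)
  rw [besselI0_eq_besselSeries, show (2 * t * z) ^ 2 / 4 = -(-t ^ 2 * z ^ 2) by ring]
  convert! h using 2 with j
  rw [neg_eq_neg_one_mul (t ^ 2), mul_pow, pow_mul]; ring

lemma radialW_eq_laguerre (j : ℕ) (z : ℝ) :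
    radialW j z = (-1) ^ j * ((2 * j).factorial : ℝ) / (j.factorial : ℝ) * laguerre j (z ^ 2) := by
  let b : ℕ → ℝ := fun j => (-1) ^ j / (j.factorial : ℝ) * laguerre j (z ^ 2)
  -- The generating function is even in t, so its odd Taylor coefficients are filled in by zero.
  let a : ℕ → ℝ := Function.extend (fun j => 2 * j) b 0
  have hinj : Function.Injective (fun j : ℕ => 2 * j) := fun i j h => by
    simpa using h
  have h : ∀ t : ℝ, HasSum (fun n : ℕ => t ^ n * a n) (exp (-t ^ 2) * besselI0 (2 * t * z)) := by
    intro t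
    rw [← hinj.hasSum_iff]
    · convert! hasSum_genFun_laguerre t z using 2 with j
      simp only [Function.comp_apply, a]
      rw [hinj.extend_apply b 0 j]
    · intro n hn
      simp only [a]
      rw [Function.extend_apply' _ _ _ (mt Set.mem_range.mpr hn)]; simp
  rw [radialW, iteratedDeriv_zero_of_hasSum (Eventually.of_forall h)]
  simp only [a]
  rw [hinj.extend_apply b 0 j]
  simp only [b]; ring

lemma hasSum_radialW (t z : ℝ) :
    HasSum (fun j : ℕ => t ^ (2 * j) / ((2 * j).factorial : ℝ) * radialW j z)
      (exp (-t ^ 2) * besselI0 (2 * t * z)) := by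
  convert! hasSum_genFun_laguerre t z using 2 with j
  rw [radialW_eq_laguerre]
  have : ((2 * j).factorial : ℝ) ≠ 0 := by positivity
  field_simp

lemma exists_polynomial_radialW (j : ℕ) :
    ∃ P : Polynomial ℝ, ∀ z : ℝ, radialW j z = P.eval z := by
  refine ⟨Polynomial.C ((-1) ^ j * ((2 * j).factorial : ℝ) / (j.factorial : ℝ)) *
    ∑ k ∈ Finset.range (j + 1), Polynomial.C ((j.choose k : ℝ) / (k.factorial : ℝ)) *
      (-Polynomial.X ^ 2) ^ k, fun z => ?_⟩
  rw [radialW_eq_laguerre, laguerre]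
  simp only [Polynomial.eval_mul, Polynomial.eval_C, Polynomial.eval_finsetSum,
    Polynomial.eval_pow, Polynomial.eval_neg, Polynomial.eval_X]
  congr 1
  exact Finset.sum_congr rfl fun k _ => by ring

lemma continuous_laguerre (j : ℕ) : Continuous (laguerre j) := by
  unfold laguerre; fun_prop

lemma besselI0_nonneg (x : ℝ) : 0 ≤ besselI0 x :=
  tsum_nonneg fun k => by rw [pow_mul]; positivity

/-- Termwise comparison with the even part of the exponential series: (2k)! ≤ 4^k (k!)², because the
central binomial coefficient is at most 4^k. -/
lemma besselI0_le_exp (x : ℝ) : besselI0 x ≤ exp |x| := by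
  rw [besselI0_eq_besselSeries]
  have h := hasSum_exp_series |x|
  have hinj : Function.Injective (fun j : ℕ => 2 * j) := fun i j h => by simpa using h
  have hb := hasSum_besselSeries (x ^ 2 / 4)
  refine (hasSum_le (fun k => ?_) hb (h.summable.comp_injective hinj).hasSum).trans ?_
  · simp only [Function.comp_apply]
    rw [pow_mul, sq_abs, div_pow, div_div]
    refine div_le_div_of_nonneg_left (by positivity) (by positivity) ?_
    have h1 : ((2 * k).choose k : ℝ) ≤ 4 ^ k := by
      have : (2 * k).choose k ≤ 2 ^ (2 * k) := Nat.choose_le_two_pow _ _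
      rw [pow_mul] at this
      exact_mod_cast this
    have h2 : ((2 * k).factorial : ℝ) = (2 * k).choose k * (k.factorial : ℝ) ^ 2 := by
      have := Nat.choose_mul_factorial_mul_factorial (show k ≤ 2 * k by omega)
      rw [show 2 * k - k = k by omega] at this
      rw [sq, ← mul_assoc]; exact_mod_cast this.symm
    rw [h2]; gcongr
  · rw [← h.tsum_eq]
    exact tsum_comp_le_tsum_of_inj h.summable (fun k => by positivity) hinj

/-! ### Poisson's integral, derivatives of J₀ and Bessel's equation -/

/-- This is Wallis's product for the mean of sin^{2k} over [0, π]; it turns the cosine coefficients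
1/(2k)! into those of J₀. -/
lemma prod_odd_div_even (k : ℕ) :
    ∏ i ∈ Finset.range k, (2 * (i : ℝ) + 1) / (2 * i + 2) =
      ((2 * k).factorial : ℝ) / (4 ^ k * (k.factorial : ℝ) ^ 2) := by
  induction k with
  | zero => simp
  | succ k ih =>
    rw [Finset.prod_range_succ, ih, show 2 * (k + 1) = 2 * k + 1 + 1 by ring, Nat.factorial_succ,
      Nat.factorial_succ, Nat.factorial_succ]
    have h1 : (k.factorial : ℝ) ≠ 0 := by positivity
    push_cast
    field_simp
    ring

/-- Poisson's integral for the Bessel function of order zero. -/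
lemma besselJ0_eq_integral (x : ℝ) :
    besselJ0 x = (1 / π) * ∫ θ in (0 : ℝ)..π, cos (x * sin θ) := by
  have h : HasSum (fun k : ℕ => ∫ θ in (0 : ℝ)..π,
      (-1) ^ k * (x * sin θ) ^ (2 * k) / ((2 * k).factorial : ℝ))
      (∫ θ in (0 : ℝ)..π, cos (x * sin θ)) := by
    refine intervalIntegral.hasSum_integral_of_dominated_convergence
      (fun k _ => |x| ^ (2 * k) / ((2 * k).factorial : ℝ)) (fun k => ?_) (fun k => ?_) ?_ ?_ ?_
    · exact Continuous.aestronglyMeasurable (by fun_prop)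
    · refine Eventually.of_forall fun θ _ => ?_
      rw [norm_div, norm_mul, norm_pow, norm_pow, norm_neg, norm_one, one_pow, one_mul,
        Real.norm_of_nonneg (by positivity : (0 : ℝ) ≤ ((2 * k).factorial : ℝ)), norm_mul,
        Real.norm_eq_abs, Real.norm_eq_abs]
      gcongr
      exact mul_le_of_le_one_right (abs_nonneg x) (abs_sin_le_one θ)
    · refine Eventually.of_forall fun θ _ => ?_
      exact (hasSum_exp_series |x|).summable.comp_injective
        (i := fun j : ℕ => 2 * j) fun i j h => by simpa using h
    · exact intervalIntegrable_const
    · exact Eventually.of_forall fun θ _ => Real.hasSum_cos _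
  rw [← (h.mul_left (1 / π)).tsum_eq, besselJ0]
  congr 1; ext k
  have : ∀ θ : ℝ, (-1) ^ k * (x * sin θ) ^ (2 * k) / ((2 * k).factorial : ℝ) =
      ((-1) ^ k * x ^ (2 * k) / ((2 * k).factorial : ℝ)) * sin θ ^ (2 * k) := fun θ => by
    rw [mul_pow]; ring
  simp_rw [this]
  rw [intervalIntegral.integral_const_mul, integral_sin_pow_even, prod_odd_div_even]
  have h1 : (k.factorial : ℝ) ≠ 0 := by positivity
  have h2 : ((2 * k).factorial : ℝ) ≠ 0 := by positivity
  rw [div_pow, pow_mul 2, show (2 : ℝ) ^ 2 = 4 by norm_num]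
  field_simp

/-- The first derivative of `J₀`. -/
noncomputable def besselJ0Deriv (x : ℝ) : ℝ :=
  (1 / π) * ∫ θ in (0 : ℝ)..π, -sin (x * sin θ) * sin θ

/-- The second derivative of `J₀`. -/
noncomputable def besselJ0Deriv2 (x : ℝ) : ℝ :=
  (1 / π) * ∫ θ in (0 : ℝ)..π, -(cos (x * sin θ) * sin θ) * sin θ

lemma hasDerivAt_besselJ0 (x : ℝ) : HasDerivAt besselJ0 (besselJ0Deriv x) x := by
  rw [funext besselJ0_eq_integral]
  refine HasDerivAt.const_mul _ ?_
  refine (intervalIntegral.hasDerivAt_integral_of_dominated_loc_of_deriv_le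
    (F := fun x θ => cos (x * sin θ)) (F' := fun x θ => -sin (x * sin θ) * sin θ)
    (bound := fun _ => 1) univ_mem
    (Eventually.of_forall fun y => Continuous.aestronglyMeasurable (by fun_prop))
    (Continuous.intervalIntegrable (by fun_prop) _ _)
    (Continuous.aestronglyMeasurable (by fun_prop)) ?_ intervalIntegrable_const ?_).2
  · refine Eventually.of_forall fun θ _ y _ => ?_
    rw [norm_mul, norm_neg]
    exact mul_le_one₀ (abs_sin_le_one _) (norm_nonneg _) (abs_sin_le_one _)
  · refine Eventually.of_forall fun θ _ y _ => ?_
    simpa using ((hasDerivAt_id y).mul_const (sin θ)).cos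

lemma hasDerivAt_besselJ0Deriv (x : ℝ) : HasDerivAt besselJ0Deriv (besselJ0Deriv2 x) x := by
  refine HasDerivAt.const_mul _ ?_
  refine (intervalIntegral.hasDerivAt_integral_of_dominated_loc_of_deriv_le
    (F := fun x θ => -sin (x * sin θ) * sin θ)
    (F' := fun x θ => -(cos (x * sin θ) * sin θ) * sin θ) (bound := fun _ => 1) univ_mem
    (Eventually.of_forall fun y => Continuous.aestronglyMeasurable (by fun_prop))
    (Continuous.intervalIntegrable (by fun_prop) _ _)
    (Continuous.aestronglyMeasurable (by fun_prop)) ?_ intervalIntegrable_const ?_).2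
  · refine Eventually.of_forall fun θ _ y _ => ?_
    rw [norm_mul, norm_neg, norm_mul]
    exact mul_le_one₀ (mul_le_one₀ (abs_cos_le_one _) (norm_nonneg _) (abs_sin_le_one _))
      (norm_nonneg _) (abs_sin_le_one _)
  · refine Eventually.of_forall fun θ _ y _ => ?_
    simpa using (((hasDerivAt_id y).mul_const (sin θ)).sin.neg).mul_const (sin θ)

lemma abs_inv_pi_mul_integral_le_one {g : ℝ → ℝ} (hg : ∀ θ, |g θ| ≤ 1) :
    |(1 / π) * ∫ θ in (0 : ℝ)..π, g θ| ≤ 1 := by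
  have h : |∫ θ in (0 : ℝ)..π, g θ| ≤ 1 * |π - 0| :=
    intervalIntegral.norm_integral_le_of_norm_le_const (f := g) (C := 1) fun θ _ => hg θ
  rw [sub_zero, abs_of_pos pi_pos, one_mul] at h
  rw [abs_mul, abs_of_pos (by positivity), one_div, inv_mul_le_iff₀ pi_pos, mul_one]
  exact h

lemma abs_besselJ0_le_one (x : ℝ) : |besselJ0 x| ≤ 1 := by
  rw [besselJ0_eq_integral]
  exact abs_inv_pi_mul_integral_le_one fun θ => abs_cos_le_one _

lemma abs_besselJ0Deriv_le_one (x : ℝ) : |besselJ0Deriv x| ≤ 1 :=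
  abs_inv_pi_mul_integral_le_one fun θ => by
    rw [abs_mul, abs_neg]
    exact mul_le_one₀ (abs_sin_le_one _) (abs_nonneg _) (abs_sin_le_one _)

lemma abs_besselJ0Deriv2_le_one (x : ℝ) : |besselJ0Deriv2 x| ≤ 1 :=
  abs_inv_pi_mul_integral_le_one fun θ => by
    rw [abs_mul, abs_neg, abs_mul]
    exact mul_le_one₀ (mul_le_one₀ (abs_cos_le_one _) (abs_nonneg _) (abs_sin_le_one _))
      (abs_nonneg _) (abs_sin_le_one _)

lemma besselJ0Deriv_zero : besselJ0Deriv 0 = 0 := by simp [besselJ0Deriv]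

lemma continuous_besselJ0 : Continuous besselJ0 :=
  continuous_iff_continuousAt.mpr fun x => (hasDerivAt_besselJ0 x).continuousAt

lemma continuous_besselJ0Deriv : Continuous besselJ0Deriv :=
  continuous_iff_continuousAt.mpr fun x => (hasDerivAt_besselJ0Deriv x).continuousAt

lemma continuous_besselJ0Deriv2 : Continuous besselJ0Deriv2 :=
  continuous_const.mul (intervalIntegral.continuous_parametric_intervalIntegral_of_continuous'
    (by fun_prop) 0 π)

/-- Bessel's differential equation of order zero. -/
lemma besselJ0_ode (x : ℝ) :
    x * besselJ0Deriv2 x + besselJ0Deriv x + x * besselJ0 x = 0 := by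
  -- The combination in Bessel's equation has an exact derivative in θ as integrand, by sin² + cos²
  -- = 1. Its primitive vanishes at 0 and π, where sin θ = 0.
  have hd : ∀ θ : ℝ, HasDerivAt (fun θ => cos θ * sin (x * sin θ))
      (-sin θ * sin (x * sin θ) + cos θ * (cos (x * sin θ) * (x * cos θ))) θ := fun θ =>
    (hasDerivAt_cos θ).mul (((hasDerivAt_sin θ).const_mul x).sin)
  have hint := intervalIntegral.integral_eq_sub_of_hasDerivAt (fun θ _ => hd θ)
    (Continuous.intervalIntegrable (by fun_prop) 0 π)
  simp only [sin_pi, mul_zero, sin_zero, sub_zero] at hint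
  rw [besselJ0_eq_integral, besselJ0Deriv, besselJ0Deriv2]
  have e : ∀ a b c : ℝ, x * (1 / π * a) + 1 / π * b + x * (1 / π * c) =
      1 / π * (x * a + b + x * c) := fun a b c => by ring
  rw [e, ← intervalIntegral.integral_const_mul, ← intervalIntegral.integral_const_mul]
  have hi : ∀ g : ℝ → ℝ, Continuous g → IntervalIntegrable g volume 0 π :=
    fun g hg => hg.intervalIntegrable _ _
  rw [← intervalIntegral.integral_add (hi _ (by fun_prop)) (hi _ (by fun_prop)),
    ← intervalIntegral.integral_add (hi _ (by fun_prop)) (hi _ (by fun_prop))]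
  rw [mul_eq_zero]; right
  refine Eq.trans ?_ hint
  refine intervalIntegral.integral_congr fun θ _ => ?_
  have := sin_sq_add_cos_sq θ
  linear_combination -x * cos (x * sin θ) * this

/-! ### Ordinary generating function and growth of Laguerre polynomials -/

/-- The ordinary generating function of the Laguerre polynomials in the complex unit disc. -/
lemma hasSum_laguerre_mul_pow (y : ℝ) {t : ℂ} (ht : ‖t‖ < 1) :
    HasSum (fun n : ℕ => t ^ n * (laguerre n y : ℂ))
      (1 / (1 - t) * Complex.exp (-(y * (t / (1 - t))))) := by
  have ht1 : (1 - t) ≠ 0 := fun h => by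
    rw [← sub_eq_zero.mp h, norm_one] at ht; exact lt_irrefl _ ht
  have hgeo : ∀ (s : ℂ), ‖s‖ < 1 → ∀ k : ℕ,
      HasSum (fun n : ℕ => (n.choose k : ℂ) * s ^ n) (s ^ k / (1 - s) ^ (k + 1)) := by
    intro s hs k
    have h := (hasSum_choose_mul_geometric_of_norm_lt_one k hs).mul_left (s ^ k)
    rw [← hasSum_nat_add_iff' k, Finset.sum_eq_zero, sub_zero]
    · rw [mul_one_div] at h
      convert! h using 2 with n
      rw [pow_add]; ring
    · intro i hi
      rw [Nat.choose_eq_zero_of_lt (Finset.mem_range.mp hi)]; simp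
  -- Double series summed in two orders: over n first it gives the closed form, over k first the
  -- Laguerre polynomials. Absolute summability follows from the same geometric sums at |y| and ‖t‖.
  let g : ℕ × ℕ → ℂ := fun p =>
    (-y : ℂ) ^ p.1 / (p.1.factorial : ℂ) * ((p.2.choose p.1 : ℂ) * t ^ p.2)
  have hfib : ∀ (y : ℝ) (s : ℂ), ‖s‖ < 1 → ∀ k : ℕ, HasSum
      (fun n : ℕ => (-y : ℂ) ^ k / (k.factorial : ℂ) * ((n.choose k : ℂ) * s ^ n))
      ((-y : ℂ) ^ k / (k.factorial : ℂ) * (s ^ k / (1 - s) ^ (k + 1))) :=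
    fun y s hs k => (hgeo s hs k).mul_left _
  have hg : Summable g := by
    refine Summable.of_norm ?_
    have hnorm : ∀ k n : ℕ, ‖g (k, n)‖ =
        |y| ^ k / (k.factorial : ℝ) * ((n.choose k : ℝ) * ‖t‖ ^ n) := fun k n => by
      simp [g]
    have hr : ∀ k : ℕ, HasSum (fun n : ℕ => ‖g (k, n)‖)
        (|y| ^ k / (k.factorial : ℝ) * (‖t‖ ^ k / (1 - ‖t‖) ^ (k + 1))) := fun k => by
      simp only [hnorm]
      refine HasSum.mul_left _ ?_
      have := hgeo (‖t‖ : ℂ) (by simpa using ht) k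
      exact_mod_cast this
    refine (summable_prod_of_nonneg fun _ => norm_nonneg _).mpr
      ⟨fun k => (hr k).summable, ?_⟩
    simp only [(hr _).tsum_eq]
    have := (Real.summable_pow_div_factorial (|y| * (‖t‖ / (1 - ‖t‖)))).mul_left (1 / (1 - ‖t‖))
    convert! this using 2 with k
    have : 1 - ‖t‖ ≠ 0 := by linarith
    rw [mul_pow, div_pow, pow_succ]
    field_simp
  have h1 := hg.hasSum.prod_fiberwise fun k => hfib y t ht k
  have h2 : HasSum (fun k : ℕ => (-y : ℂ) ^ k / (k.factorial : ℂ) * (t ^ k / (1 - t) ^ (k + 1)))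
      (1 / (1 - t) * Complex.exp (-(y * (t / (1 - t))))) := by
    have := (NormedSpace.expSeries_div_hasSum_exp (-(y * (t / (1 - t))) : ℂ)).mul_left (1 / (1 - t))
    rw [← Complex.exp_eq_exp_ℂ] at this
    convert! this using 2 with k
    rw [neg_mul_eq_neg_mul, mul_pow, div_pow, pow_succ]
    field_simp
  rw [← h1.unique h2]
  have h3 := (Equiv.prodComm ℕ ℕ).hasSum_iff.mpr hg.hasSum
  refine h3.prod_fiberwise fun n => ?_
  have : (laguerre n y : ℂ) = ∑ k ∈ Finset.range (n + 1), (n.choose k : ℂ) * (-y : ℂ) ^ k /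
      (k.factorial : ℂ) := by simp [laguerre]
  have hfin : HasSum (fun k : ℕ => g (k, n)) (∑ k ∈ Finset.range (n + 1), g (k, n)) := by
    refine hasSum_sum_of_ne_finset_zero fun k hk => ?_
    simp only [g]
    rw [Nat.choose_eq_zero_of_lt (by simpa using hk)]; simp
  have hsum : t ^ n * (laguerre n y : ℂ) = ∑ k ∈ Finset.range (n + 1), g (k, n) := by
    rw [this, Finset.mul_sum]
    refine Finset.sum_congr rfl fun k _ => ?_
    simp only [g]
    ring
  rw [hsum]
  exact hfin

/-- Cauchy's estimate on the circle |t| = q. There the prefactor is largest at t = q and the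
exponential at t = -q; bounding the two separately costs nothing in the exponent, which determines
the admissible c. -/
lemma abs_laguerre_mul_pow_le (n : ℕ) {y q : ℝ} (hy : 0 ≤ y) (hq0 : 0 < q) (hq1 : q < 1) :
    |laguerre n y| * q ^ n ≤ exp (y * (q / (1 + q))) / (1 - q) := by
  let G : ℂ → ℂ := fun t => 1 / (1 - t) * Complex.exp (-(y * (t / (1 - t))))
  have hne : ∀ t : ℂ, ‖t‖ < 1 → 1 - t ≠ 0 := fun t ht h => by
    rw [← sub_eq_zero.mp h, norm_one] at ht; exact lt_irrefl _ ht
  have hG : DiffContOnCl ℂ G (Metric.ball 0 q) := by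
    refine DifferentiableOn.diffContOnCl fun t ht => ?_
    have : ‖t‖ < 1 := by
      rw [closure_ball _ hq0.ne'] at ht
      exact (mem_closedBall_zero_iff.mp ht).trans_lt hq1
    have := hne t this
    refine DifferentiableAt.differentiableWithinAt ?_
    simp only [G]
    fun_prop (disch := assumption)
  have hbound : ∀ t ∈ Metric.sphere (0 : ℂ) q, ‖G t‖ ≤ exp (y * (q / (1 + q))) / (1 - q) := by
    intro t ht
    have htq : ‖t‖ = q := by simpa using ht
    have hlow : 1 - q ≤ ‖1 - t‖ := by
      have := norm_sub_norm_le (1 : ℂ) t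
      rwa [norm_one, htq] at this
    have hup : ‖1 - t‖ ≤ 1 + q := by
      have := norm_sub_le (1 : ℂ) t
      rwa [norm_one, htq] at this
    have h0 : 0 < ‖1 - t‖ := lt_of_lt_of_le (by linarith) hlow
    rw [norm_mul, Complex.norm_exp, norm_div, norm_one, one_div, inv_mul_eq_div]
    refine div_le_div₀ (exp_pos _).le (exp_le_exp.mpr ?_) (by linarith) hlow
    rw [Complex.neg_re, Complex.re_ofReal_mul, ← mul_neg]
    refine mul_le_mul_of_nonneg_left ?_ hy
    rw [Complex.div_re, Complex.normSq_eq_norm_sq]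
    have hn : ‖1 - t‖ ^ 2 = (1 - t.re) ^ 2 + t.im ^ 2 := by
      rw [← Complex.normSq_eq_norm_sq, Complex.normSq_apply]; simp; ring
    have hq : q ^ 2 = t.re ^ 2 + t.im ^ 2 := by
      rw [← htq, ← Complex.normSq_eq_norm_sq, Complex.normSq_apply]; ring
    have hre : -q ≤ t.re := by
      have := (abs_le.mp (Complex.abs_re_le_norm t)).1
      rwa [htq] at this
    rw [← add_div, ← neg_div, div_le_div_iff₀ (by positivity) (by positivity), hn]
    simp only [Complex.sub_re, Complex.one_re, Complex.sub_im, Complex.one_im]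
    -- With denominators cleared the claim is (1 - q)(q + Re t) ≥ 0.
    nlinarith
  have h := Complex.norm_iteratedDeriv_le_of_forall_mem_sphere_norm_le n hq0 hG hbound
  have hs : ∀ᶠ t in 𝓝 (0 : ℂ), HasSum (fun n : ℕ => t ^ n * (laguerre n y : ℂ)) (G t) := by
    filter_upwards [Metric.ball_mem_nhds (0 : ℂ) one_pos] with t ht
    exact hasSum_laguerre_mul_pow y (by simpa using ht)
  rw [iteratedDeriv_zero_of_hasSum hs, norm_mul, Complex.norm_natCast, Complex.norm_real,
    mul_div_assoc, Real.norm_eq_abs] at h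
  have hf : (0 : ℝ) < n.factorial := by positivity
  have h' := le_of_mul_le_mul_left h hf
  rwa [le_div_iff₀ (by positivity)] at h'

/-! ### Gaussian integrals of Bessel functions -/

lemma integrableOn_pow_mul_exp_neg_sq (n : ℕ) {a : ℝ} (ha : 0 < a) :
    IntegrableOn (fun l : ℝ => l ^ n * exp (-l ^ 2 * a)) (Ioi 0) := by
  have h := integrableOn_rpow_mul_exp_neg_mul_sq ha (s := n)
    (by have : (0 : ℝ) ≤ n := n.cast_nonneg
        linarith)
  refine h.congr_fun (fun l _ => ?_) measurableSet_Ioi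
  simp only [rpow_natCast]
  congr 2; ring

lemma integral_pow_mul_exp_neg_sq (k : ℕ) {a : ℝ} (ha : 0 < a) :
    ∫ l in Ioi (0 : ℝ), l ^ (2 * k + 1) * exp (-l ^ 2 * a) =
      (k.factorial : ℝ) / (2 * a ^ (k + 1)) := by
  have h := integral_rpow_mul_exp_neg_mul_rpow (p := 2) (q := (2 * k + 1 : ℕ)) two_pos
    (by have : (0 : ℝ) ≤ ((2 * k + 1 : ℕ) : ℝ) := Nat.cast_nonneg _
        linarith) ha
  have e : (((2 * k + 1 : ℕ) : ℝ) + 1) / 2 = (k : ℝ) + 1 := by push_cast; ring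
  rw [neg_div, e, Real.Gamma_nat_eq_factorial, rpow_neg ha.le,
    show (k : ℝ) + 1 = ((k + 1 : ℕ) : ℝ) by push_cast; ring, rpow_natCast] at h
  rw [show (k.factorial : ℝ) / (2 * a ^ (k + 1)) = (a ^ (k + 1))⁻¹ * (1 / 2) * k.factorial by
    field_simp, ← h]
  refine setIntegral_congr_fun measurableSet_Ioi fun l _ => ?_
  simp only [rpow_natCast, rpow_ofNat]
  congr 2; ring

lemma integrableOn_pow_mul_exp_neg_sq_mul (n : ℕ) {a : ℝ} (ha : 0 < a) {h : ℝ → ℝ}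
    (hh : Continuous h) (hb : ∀ l, |h l| ≤ 1) :
    IntegrableOn (fun l : ℝ => l ^ n * exp (-l ^ 2 * a) * h l) (Ioi 0) :=
  Integrable.mul_bdd (c := 1) (integrableOn_pow_mul_exp_neg_sq n ha)
    hh.aestronglyMeasurable (Eventually.of_forall hb)

lemma integral_abs_pow_mul_exp_neg_sq_mul_le (k : ℕ) {a : ℝ} (ha : 0 < a) {h : ℝ → ℝ}
    (hh : Continuous h) (hb : ∀ l, |h l| ≤ 1) :
    ∫ l in Ioi (0 : ℝ), |l ^ (2 * k + 1) * exp (-l ^ 2 * a) * h l| ≤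
      (k.factorial : ℝ) / (2 * a ^ (k + 1)) := by
  rw [← integral_pow_mul_exp_neg_sq k ha]
  refine setIntegral_mono_on (integrableOn_pow_mul_exp_neg_sq_mul _ ha hh hb).abs
    (integrableOn_pow_mul_exp_neg_sq _ ha) measurableSet_Ioi fun l hl => ?_
  have hl' : (0 : ℝ) < l := hl
  rw [abs_mul, abs_of_nonneg (by positivity)]
  exact mul_le_of_le_one_right (by positivity) (hb l)

/-- Termwise integration of an even power series against a Gaussian. -/
lemma hasSum_integral_gaussian_series {c : ℕ → ℝ} {g h : ℝ → ℝ} {a : ℝ} (ha : 0 < a) (j : ℕ)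
    (hg : ∀ l, HasSum (fun k : ℕ => c k * l ^ (2 * k)) (g l))
    (hh : Continuous h) (hb : ∀ l, |h l| ≤ 1)
    (hs : Summable fun k : ℕ => |c k| * (((j + k).factorial : ℝ) / (2 * a ^ (j + k + 1)))) :
    HasSum (fun k : ℕ => c k * ∫ l in Ioi (0 : ℝ), l ^ (2 * (j + k) + 1) * exp (-l ^ 2 * a) * h l)
      (∫ l in Ioi (0 : ℝ), l ^ (2 * j + 1) * exp (-l ^ 2 * a) * (g l * h l)) := by
  have key := hasSum_integral_of_summable_integral_norm (μ := volume.restrict (Ioi (0 : ℝ)))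
    (F := fun (k : ℕ) l => c k * (l ^ (2 * (j + k) + 1) * exp (-l ^ 2 * a) * h l))
    (fun k => (integrableOn_pow_mul_exp_neg_sq_mul _ ha hh hb).const_mul _) ?_
  · simp only [integral_const_mul] at key
    have hval : ∀ l, ∑' k : ℕ, c k * (l ^ (2 * (j + k) + 1) * exp (-l ^ 2 * a) * h l) =
        l ^ (2 * j + 1) * exp (-l ^ 2 * a) * (g l * h l) := fun l => by
      refine HasSum.tsum_eq ?_
      rw [mul_comm (g l), ← mul_assoc]
      convert! (hg l).mul_left (l ^ (2 * j + 1) * exp (-l ^ 2 * a) * h l) using 1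
      funext k
      ring
    simpa only [hval] using key
  · refine Summable.of_nonneg_of_le (fun k => integral_nonneg fun _ => norm_nonneg _)
      (fun k => ?_) hs
    simp only [norm_mul (c k), integral_const_mul, Real.norm_eq_abs]
    exact mul_le_mul_of_nonneg_left (integral_abs_pow_mul_exp_neg_sq_mul_le _ ha hh hb)
      (abs_nonneg _)

lemma hasSum_besselJ0_mul (r l : ℝ) :
    HasSum (fun k : ℕ => (-(r ^ 2 / 4)) ^ k / (k.factorial : ℝ) ^ 2 * l ^ (2 * k))
      (besselJ0 (l * r)) := by
  rw [besselJ0_eq_besselSeries]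
  convert! hasSum_besselSeries (-((l * r) ^ 2 / 4)) using 2 with k
  rw [show -((l * r) ^ 2 / 4) = -(r ^ 2 / 4) * l ^ 2 by ring, mul_pow, pow_mul]; ring

lemma hasSum_besselI0_mul (r l : ℝ) :
    HasSum (fun k : ℕ => (r ^ 2 / 4) ^ k / (k.factorial : ℝ) ^ 2 * l ^ (2 * k))
      (besselI0 (l * r)) := by
  rw [besselI0_eq_besselSeries]
  convert! hasSum_besselSeries ((l * r) ^ 2 / 4) using 2 with k
  rw [show (l * r) ^ 2 / 4 = r ^ 2 / 4 * l ^ 2 by ring, mul_pow, pow_mul]; ring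

/-- Bessel coefficient times Gaussian moment is, up to sign and a factor free of k, the coefficient
in Kummer's transformation. -/
lemma factorial_ratio_identity (j k : ℕ) {a : ℝ} (ha : 0 < a) (r : ℝ) :
    (r ^ 2 / 4) ^ k / (k.factorial : ℝ) ^ 2 * (((j + k).factorial : ℝ) / (2 * a ^ (j + k + 1))) =
      (j.factorial : ℝ) / (2 * a ^ (j + 1)) *
        (((j + k).choose k : ℝ) * (r ^ 2 / (4 * a)) ^ k / (k.factorial : ℝ)) := by
  rw [Nat.cast_choose ℝ (Nat.le_add_left k j), Nat.add_sub_cancel]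
  have h1 : (k.factorial : ℝ) ≠ 0 := by positivity
  have h2 : (j.factorial : ℝ) ≠ 0 := by positivity
  rw [← div_div (r ^ 2) 4 a, div_pow (r ^ 2 / 4) a, show j + k + 1 = j + 1 + k by ring,
    pow_add a (j + 1)]
  field_simp

lemma integral_pow_mul_exp_mul_besselJ0 (j : ℕ) {a : ℝ} (ha : 0 < a) (r : ℝ) :
    ∫ l in Ioi (0 : ℝ), l ^ (2 * j + 1) * exp (-l ^ 2 * a) * besselJ0 (l * r) =
      (j.factorial : ℝ) / (2 * a ^ (j + 1)) *
        (exp (-(r ^ 2 / (4 * a))) * laguerre j (r ^ 2 / (4 * a))) := by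
  have h := hasSum_integral_gaussian_series (h := fun _ => 1) ha j (hasSum_besselJ0_mul r)
    continuous_const (by simp) ?_
  · simp only [mul_one, integral_pow_mul_exp_neg_sq _ ha] at h
    refine h.unique ?_
    convert! (hasSum_choose_mul_pow_div_factorial j (r ^ 2 / (4 * a))).mul_left
      ((j.factorial : ℝ) / (2 * a ^ (j + 1))) using 2 with k
    have := factorial_ratio_identity j k ha r
    rw [neg_pow, neg_pow (r ^ 2 / (4 * a))]
    linear_combination (-1) ^ k * this
  -- The absolute values are the terms of the same Kummer series at the opposite argument.
  · have := (hasSum_choose_mul_pow_div_factorial j (-(r ^ 2 / (4 * a)))).mul_left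
      ((j.factorial : ℝ) / (2 * a ^ (j + 1)))
    rw [neg_neg] at this
    convert! this.summable using 2 with k
    rw [← factorial_ratio_identity j k ha r, abs_div, abs_pow, abs_neg,
      abs_of_nonneg (by positivity : 0 ≤ r ^ 2 / 4), abs_of_nonneg (by positivity)]

/-! ### The radial heat kernel -/

/-- The radial heat kernel in the plane. -/
noncomputable def radialKernel (τ ρ ξ : ℝ) : ℝ :=
  1 / (2 * τ) * exp (-(ρ ^ 2 + ξ ^ 2) / (4 * τ)) * besselI0 (ρ * ξ / (2 * τ))

/-- Weber's second exponential integral. -/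
lemma integral_exp_mul_besselJ0_mul_besselJ0 {τ : ℝ} (hτ : 0 < τ) (ρ ξ : ℝ) :
    ∫ l in Ioi (0 : ℝ), l * exp (-l ^ 2 * τ) * (besselJ0 (l * ρ) * besselJ0 (l * ξ)) =
      radialKernel τ ρ ξ := by
  -- Only J₀(lρ) is expanded; J₀(lξ) stays as the bounded factor. Each term is then a Laguerre
  -- integral, and the exponential generating function at s = -ρ²/(4τ) resums them.
  have h := hasSum_integral_gaussian_series (h := fun l => besselJ0 (l * ξ)) hτ 0
    (hasSum_besselJ0_mul ρ) (continuous_besselJ0.comp (by fun_prop))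
    (fun l => abs_besselJ0_le_one _) ?_
  · simp only [mul_zero, zero_add, pow_one, integral_pow_mul_exp_mul_besselJ0 _ hτ] at h
    refine h.unique ?_
    have h2 := (hasSum_laguerre_div_factorial (-(ρ ^ 2 / (4 * τ))) (ξ ^ 2 / (4 * τ))).mul_left
      (1 / (2 * τ) * exp (-(ξ ^ 2 / (4 * τ))))
    convert! h2 using 1
    · funext k
      have h1 : (k.factorial : ℝ) ≠ 0 := by positivity
      rw [← div_div (ρ ^ 2) 4 τ, ← neg_div τ (ρ ^ 2 / 4),
        div_pow (-(ρ ^ 2 / 4)) τ]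
      field_simp
      ring
    · rw [radialKernel, besselI0_eq_besselSeries, neg_add, add_div, exp_add, neg_div, neg_div,
        show (ρ * ξ / (2 * τ)) ^ 2 / 4 = -(-(ρ ^ 2 / (4 * τ)) * (ξ ^ 2 / (4 * τ))) by
          field_simp; norm_num]
      ring
  · convert! ((Real.summable_pow_div_factorial (ρ ^ 2 / 4 / τ)).mul_left (1 / (2 * τ))) using 1
    funext k
    rw [abs_div, abs_pow, abs_neg, abs_of_nonneg (by positivity : 0 ≤ ρ ^ 2 / 4),
      abs_of_nonneg (by positivity), zero_add, div_pow (ρ ^ 2 / 4) τ]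
    have h1 : (k.factorial : ℝ) ≠ 0 := by positivity
    field_simp
    ring

lemma radialKernel_nonneg {τ : ℝ} (hτ : 0 < τ) (ρ ξ : ℝ) : 0 ≤ radialKernel τ ρ ξ :=
  mul_nonneg (by positivity) (besselI0_nonneg _)

/-- The bound I₀(x) ≤ e^x for x ≥ 0 completes the square in the exponent. -/
lemma radialKernel_le {τ ρ ξ : ℝ} (hτ : 0 < τ) (hρ : 0 ≤ ρ) (hξ : 0 ≤ ξ) :
    radialKernel τ ρ ξ ≤ 1 / (2 * τ) * exp (-(ξ - ρ) ^ 2 / (4 * τ)) := by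
  have h : besselI0 (ρ * ξ / (2 * τ)) ≤ exp (ρ * ξ / (2 * τ)) := by
    simpa [abs_of_nonneg (by positivity : 0 ≤ ρ * ξ / (2 * τ))] using
      besselI0_le_exp (ρ * ξ / (2 * τ))
  refine (mul_le_mul_of_nonneg_left h (by positivity)).trans_eq ?_
  rw [mul_assoc, ← exp_add]
  congr 2
  field_simp; ring

/-- Termwise integration of the I₀ series yields e^{ρ²/(4τ)}, which cancels the Gaussian prefactor
in ρ. -/
lemma integral_radialKernel {τ : ℝ} (hτ : 0 < τ) (ρ : ℝ) :
    ∫ ξ in Ioi (0 : ℝ), radialKernel τ ρ ξ * ξ = 1 := by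
  have ha : 0 < 1 / (4 * τ) := by positivity
  have hterm : ∀ k : ℕ, ((ρ / (2 * τ)) ^ 2 / 4) ^ k / (k.factorial : ℝ) ^ 2 *
      ((k.factorial : ℝ) / (2 * (1 / (4 * τ)) ^ (k + 1))) =
      2 * τ * ((ρ ^ 2 / (4 * τ)) ^ k / (k.factorial : ℝ)) := fun k => by
    have h1 : (k.factorial : ℝ) ≠ 0 := by positivity
    rw [show ρ ^ 2 / (4 * τ) = (ρ / (2 * τ)) ^ 2 / 4 * (4 * τ) by field_simp; norm_num, one_div,
      mul_pow, inv_pow, pow_succ (4 * τ)]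
    field_simp; norm_num
  have hexp := (hasSum_exp_series (ρ ^ 2 / (4 * τ))).mul_left (2 * τ)
  have h := hasSum_integral_gaussian_series (h := fun _ => 1) ha 0
    (hasSum_besselI0_mul (ρ / (2 * τ))) continuous_const (by simp) ?_
  · simp only [mul_one, integral_pow_mul_exp_neg_sq _ ha, zero_add, mul_zero, pow_one, hterm] at h
    have h' := h.unique hexp
    have hfun : ∀ ξ : ℝ, radialKernel τ ρ ξ * ξ = 1 / (2 * τ) * exp (-(ρ ^ 2 / (4 * τ))) *
        (ξ * exp (-ξ ^ 2 * (1 / (4 * τ))) * besselI0 (ξ * (ρ / (2 * τ)))) := fun ξ => by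
      rw [radialKernel, neg_add, add_div, exp_add, neg_div, mul_one_div (-ξ ^ 2),
        show ξ * (ρ / (2 * τ)) = ρ * ξ / (2 * τ) by ring]
      ring
    simp only [hfun]
    rw [integral_const_mul, h', exp_neg]
    have := (exp_pos (ρ ^ 2 / (4 * τ))).ne'
    field_simp
  · refine hexp.summable.congr fun k => ?_
    rw [← hterm, zero_add, abs_of_nonneg (by positivity)]

/-! ### Differentiation under the integral and the heat equation -/

/-- The Gaussian-damped transform `∫_0^∞ l^n exp(-l² τ) φ(l r) H(l) dl`. -/
noncomputable def gaussianTransform (n : ℕ) (φ H : ℝ → ℝ) (τ r : ℝ) : ℝ :=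
  ∫ l in Ioi (0 : ℝ), l ^ n * exp (-l ^ 2 * τ) * φ (l * r) * H l

section
variable {φ ψ H : ℝ → ℝ} {M : ℝ}

lemma gaussianTransform_integrable (n : ℕ) (hφ : Continuous φ) (hφb : ∀ x, |φ x| ≤ 1)
    (hH : Continuous H) (hHb : ∀ l, |H l| ≤ M) {τ : ℝ} (hτ : 0 < τ) (r : ℝ) :
    IntegrableOn (fun l => l ^ n * exp (-l ^ 2 * τ) * φ (l * r) * H l) (Ioi 0) :=
  Integrable.mul_bdd (c := M) (integrableOn_pow_mul_exp_neg_sq_mul n hτ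
    (hφ.comp (continuous_mul_const r)) fun _ => hφb _)
    hH.aestronglyMeasurable (Eventually.of_forall hHb)

/-- The majorant at time σ serves all later times and all radii at once, as dominated convergence
requires. -/
lemma norm_gaussianTransform_integrand_le (n : ℕ) (hφb : ∀ x, |φ x| ≤ 1)
    (hHb : ∀ l, |H l| ≤ M) {σ τ : ℝ} (hτ : σ ≤ τ) (r : ℝ) {l : ℝ} (hl : 0 < l) :
    ‖l ^ n * exp (-l ^ 2 * τ) * φ (l * r) * H l‖ ≤ l ^ n * exp (-l ^ 2 * σ) * M := by
  rw [norm_mul, norm_mul, Real.norm_of_nonneg (by positivity : 0 ≤ l ^ n * exp (-l ^ 2 * τ))]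
  refine mul_le_mul ?_ (hHb l) (norm_nonneg _) (by positivity)
  refine (mul_le_of_le_one_right (by positivity) (hφb _)).trans ?_
  refine mul_le_mul_of_nonneg_left (exp_le_exp.mpr ?_) (by positivity)
  nlinarith [sq_nonneg l]

lemma continuousAt_gaussianTransform (n : ℕ) (hφ : Continuous φ) (hφb : ∀ x, |φ x| ≤ 1)
    (hH : Continuous H) (hHb : ∀ l, |H l| ≤ M) {p : ℝ × ℝ} (hp : 0 < p.1) :
    ContinuousAt (fun p : ℝ × ℝ => gaussianTransform n φ H p.1 p.2) p := by
  have hev : ∀ᶠ x : ℝ × ℝ in 𝓝 p, p.1 / 2 ≤ x.1 :=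
    (continuous_fst.tendsto p).eventually (Ici_mem_nhds (half_lt_self hp))
  refine continuousAt_of_dominated (bound := fun l => l ^ n * exp (-l ^ 2 * (p.1 / 2)) * M)
    (Eventually.of_forall fun x => Continuous.aestronglyMeasurable (by fun_prop)) ?_
    ((integrableOn_pow_mul_exp_neg_sq n (half_pos hp)).mul_const M)
    (Eventually.of_forall fun l => Continuous.continuousAt (by fun_prop))
  filter_upwards [hev] with x hx
  filter_upwards [ae_restrict_mem measurableSet_Ioi] with l hl
  exact norm_gaussianTransform_integrand_le n hφb hHb hx x.2 hl

lemma hasDerivAt_gaussianTransform_time (n : ℕ) (hφ : Continuous φ) (hφb : ∀ x, |φ x| ≤ 1)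
    (hH : Continuous H) (hHb : ∀ l, |H l| ≤ M) {τ : ℝ} (hτ : 0 < τ) (r : ℝ) :
    HasDerivAt (fun t => gaussianTransform n φ H t r) (-gaussianTransform (n + 2) φ H τ r) τ := by
  have h := hasDerivAt_integral_of_dominated_loc_of_deriv_le (μ := volume.restrict (Ioi (0 : ℝ)))
    (F := fun t l => l ^ n * exp (-l ^ 2 * t) * φ (l * r) * H l)
    (F' := fun t l => -(l ^ (n + 2) * exp (-l ^ 2 * t) * φ (l * r) * H l))
    (bound := fun l => l ^ (n + 2) * exp (-l ^ 2 * (τ / 2)) * M)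
    (Ici_mem_nhds (half_lt_self hτ))
    (Eventually.of_forall fun t => Continuous.aestronglyMeasurable (by fun_prop))
    (gaussianTransform_integrable n hφ hφb hH hHb hτ r)
    (Continuous.aestronglyMeasurable (by fun_prop)) ?_
    ((integrableOn_pow_mul_exp_neg_sq (n + 2) (half_pos hτ)).mul_const M) ?_
  · have h2 := h.2
    rw [integral_neg] at h2
    exact h2
  · filter_upwards [ae_restrict_mem measurableSet_Ioi] with l hl t ht
    rw [norm_neg]
    exact norm_gaussianTransform_integrand_le (n + 2) hφb hHb ht r hl
  · refine Eventually.of_forall fun l t _ => ?_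
    have := (((((hasDerivAt_id t).const_mul (-l ^ 2)).exp).const_mul (l ^ n)).mul_const
      (φ (l * r))).mul_const (H l)
    convert! this using 1
    simp only [id, mul_one]
    ring

lemma hasDerivAt_gaussianTransform_radius (n : ℕ) (hφψ : ∀ x, HasDerivAt φ (ψ x) x)
    (hφb : ∀ x, |φ x| ≤ 1) (hψ : Continuous ψ) (hψb : ∀ x, |ψ x| ≤ 1)
    (hH : Continuous H) (hHb : ∀ l, |H l| ≤ M) {τ : ℝ} (hτ : 0 < τ) (r : ℝ) :
    HasDerivAt (gaussianTransform n φ H τ) (gaussianTransform (n + 1) ψ H τ r) r := by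
  have hφ : Continuous φ := continuous_iff_continuousAt.mpr fun x => (hφψ x).continuousAt
  refine (hasDerivAt_integral_of_dominated_loc_of_deriv_le (μ := volume.restrict (Ioi (0 : ℝ)))
    (F := fun r l => l ^ n * exp (-l ^ 2 * τ) * φ (l * r) * H l)
    (F' := fun r l => l ^ (n + 1) * exp (-l ^ 2 * τ) * ψ (l * r) * H l)
    (bound := fun l => l ^ (n + 1) * exp (-l ^ 2 * τ) * M) univ_mem
    (Eventually.of_forall fun t => Continuous.aestronglyMeasurable (by fun_prop))
    (gaussianTransform_integrable n hφ hφb hH hHb hτ r)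
    (Continuous.aestronglyMeasurable (by fun_prop)) ?_
    ((integrableOn_pow_mul_exp_neg_sq (n + 1) hτ).mul_const M) ?_).2
  · filter_upwards [ae_restrict_mem measurableSet_Ioi] with l hl t _
    exact norm_gaussianTransform_integrand_le (n + 1) hψb hHb le_rfl t hl
  · refine Eventually.of_forall fun l t _ => ?_
    have h1 : HasDerivAt (fun t => φ (l * t)) (ψ (l * t) * (l * 1)) t :=
      (hφψ (l * t)).comp t ((hasDerivAt_id t).const_mul l)
    convert! (h1.const_mul (l ^ n * exp (-l ^ 2 * τ))).mul_const (H l) using 1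
    ring

end

section
variable {f : ℝ → ℝ}

lemma continuous_hankelTransform (hf : IntegrableOn (fun ξ => ξ * f ξ) (Ioi 0)) :
    Continuous (hankelTransform f) := by
  refine continuous_of_dominated (bound := fun ξ => ‖ξ * f ξ‖) (fun l => ?_) (fun l => ?_)
    hf.norm ?_
  · have : (fun ξ => ξ * besselJ0 (l * ξ) * f ξ) = fun ξ => besselJ0 (l * ξ) * (ξ * f ξ) := by
      ext ξ; ring
    rw [this]
    exact (continuous_besselJ0.comp (continuous_const_mul l)).aestronglyMeasurable.mul
      hf.aestronglyMeasurable
  · refine Eventually.of_forall fun ξ => ?_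
    rw [show ξ * besselJ0 (l * ξ) * f ξ = besselJ0 (l * ξ) * (ξ * f ξ) by ring, norm_mul]
    exact mul_le_of_le_one_left (norm_nonneg _) (abs_besselJ0_le_one _)
  · have := continuous_besselJ0
    exact Eventually.of_forall fun ξ => by fun_prop

lemma abs_hankelTransform_le (hf : IntegrableOn (fun ξ => ξ * f ξ) (Ioi 0)) (l : ℝ) :
    |hankelTransform f l| ≤ ∫ ξ in Ioi (0 : ℝ), |ξ * f ξ| := by
  refine norm_integral_le_of_norm_le (f := fun ξ => ξ * besselJ0 (l * ξ) * f ξ) hf.abs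
    (Eventually.of_forall fun ξ => ?_)
  rw [show ξ * besselJ0 (l * ξ) * f ξ = besselJ0 (l * ξ) * (ξ * f ξ) by ring, norm_mul]
  exact mul_le_of_le_one_left (norm_nonneg _) (abs_besselJ0_le_one _)

lemma radialHeat_eq_gaussianTransform (f : ℝ → ℝ) (τ r : ℝ) :
    radialHeat f τ r = gaussianTransform 1 besselJ0 (hankelTransform f) τ r := by
  simp only [radialHeat, gaussianTransform, pow_one]

lemma hasDerivAt_radialHeat_time (hf : IntegrableOn (fun ξ => ξ * f ξ) (Ioi 0)) {τ : ℝ}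
    (hτ : 0 < τ) (r : ℝ) : HasDerivAt (fun t => radialHeat f t r)
      (-gaussianTransform 3 besselJ0 (hankelTransform f) τ r) τ := by
  simp only [radialHeat_eq_gaussianTransform]
  exact hasDerivAt_gaussianTransform_time 1 continuous_besselJ0 abs_besselJ0_le_one
    (continuous_hankelTransform hf) (abs_hankelTransform_le hf) hτ r

lemma hasDerivAt_radialHeat_radius (hf : IntegrableOn (fun ξ => ξ * f ξ) (Ioi 0)) {τ : ℝ}
    (hτ : 0 < τ) (r : ℝ) : HasDerivAt (radialHeat f τ)
      (gaussianTransform 2 besselJ0Deriv (hankelTransform f) τ r) r := by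
  rw [funext (radialHeat_eq_gaussianTransform f τ)]
  exact hasDerivAt_gaussianTransform_radius 1 hasDerivAt_besselJ0 abs_besselJ0_le_one
    continuous_besselJ0Deriv abs_besselJ0Deriv_le_one
    (continuous_hankelTransform hf) (abs_hankelTransform_le hf) hτ r

lemma hasDerivAt_deriv_radialHeat (hf : IntegrableOn (fun ξ => ξ * f ξ) (Ioi 0)) {τ : ℝ}
    (hτ : 0 < τ) (r : ℝ) : HasDerivAt (deriv (radialHeat f τ))
      (gaussianTransform 3 besselJ0Deriv2 (hankelTransform f) τ r) r := by
  rw [funext fun r => (hasDerivAt_radialHeat_radius hf hτ r).deriv]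
  exact hasDerivAt_gaussianTransform_radius 2 hasDerivAt_besselJ0Deriv abs_besselJ0Deriv_le_one
    continuous_besselJ0Deriv2 abs_besselJ0Deriv2_le_one
    (continuous_hankelTransform hf) (abs_hankelTransform_le hf) hτ r

lemma radialHeat_heat_equation (hf : IntegrableOn (fun ξ => ξ * f ξ) (Ioi 0)) {τ r : ℝ}
    (hτ : 0 < τ) (hr : 0 < r) :
    deriv (fun t => radialHeat f t r) τ =
      deriv (deriv (radialHeat f τ)) r + (1 / r) * deriv (radialHeat f τ) r := by
  rw [(hasDerivAt_radialHeat_time hf hτ r).deriv, (hasDerivAt_deriv_radialHeat hf hτ r).deriv,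
    (hasDerivAt_radialHeat_radius hf hτ r).deriv]
  have hH := continuous_hankelTransform hf
  have hHb := abs_hankelTransform_le hf
  unfold gaussianTransform
  rw [← integral_neg, ← integral_const_mul, ← integral_add
    (gaussianTransform_integrable 3 continuous_besselJ0Deriv2 abs_besselJ0Deriv2_le_one hH hHb hτ r)
    ((gaussianTransform_integrable 2 continuous_besselJ0Deriv abs_besselJ0Deriv_le_one hH hHb
      hτ r).const_mul _)]
  congr 1; ext l
  -- The two integrands agree pointwise by Bessel's equation at lr.
  have := besselJ0_ode (l * r)
  field_simp
  linear_combination (-l ^ 2 * hankelTransform f l) * this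

lemma radialHeat_regular_at_pole (hf : IntegrableOn (fun ξ => ξ * f ξ) (Ioi 0)) {τ : ℝ}
    (hτ : 0 < τ) : HasDerivAt (radialHeat f τ) 0 0 := by
  convert! hasDerivAt_radialHeat_radius hf hτ 0 using 1
  simp [gaussianTransform, besselJ0Deriv_zero]

lemma continuousAt_radialHeat (hf : IntegrableOn (fun ξ => ξ * f ξ) (Ioi 0)) {p : ℝ × ℝ}
    (hp : 0 < p.1) : ContinuousAt (fun p : ℝ × ℝ => radialHeat f p.1 p.2) p := by
  simp only [radialHeat_eq_gaussianTransform]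
  exact continuousAt_gaussianTransform 1 continuous_besselJ0 abs_besselJ0_le_one
    (continuous_hankelTransform hf) (abs_hankelTransform_le hf) hp

end

/-! ### Kernel representation and initial values -/

section
variable {f : ℝ → ℝ}

/-- Justifies Fubini: apart from two Bessel factors bounded by 1, the integrand is a product of
integrable functions of one variable. -/
lemma integrable_heat_prod (hf : IntegrableOn (fun ξ => ξ * f ξ) (Ioi 0)) {τ : ℝ} (hτ : 0 < τ)
    (r : ℝ) : Integrable (fun p : ℝ × ℝ => p.1 * exp (-p.1 ^ 2 * τ) * (p.2 * f p.2) *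
      (besselJ0 (p.1 * r) * besselJ0 (p.1 * p.2)))
      ((volume.restrict (Ioi 0)).prod (volume.restrict (Ioi 0))) := by
  have h1 := integrableOn_pow_mul_exp_neg_sq 1 hτ
  simp only [pow_one] at h1
  have hc := continuous_besselJ0
  refine (h1.mul_prod hf).mul_bdd (c := 1) (Continuous.aestronglyMeasurable (by fun_prop))
    (Eventually.of_forall fun p => ?_)
  rw [norm_mul]
  exact mul_le_one₀ (abs_besselJ0_le_one _) (norm_nonneg _) (abs_besselJ0_le_one _)

lemma radialHeat_eq_integral_prod (hf : IntegrableOn (fun ξ => ξ * f ξ) (Ioi 0)) {τ : ℝ}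
    (hτ : 0 < τ) (r : ℝ) : radialHeat f τ r = ∫ p : ℝ × ℝ,
      p.1 * exp (-p.1 ^ 2 * τ) * (p.2 * f p.2) * (besselJ0 (p.1 * r) * besselJ0 (p.1 * p.2))
      ∂(volume.restrict (Ioi 0)).prod (volume.restrict (Ioi 0)) := by
  rw [integral_prod _ (integrable_heat_prod hf hτ r), radialHeat]
  congr 1; ext l
  rw [hankelTransform, ← integral_const_mul]
  congr 1; ext ξ
  ring

/-- The Fourier-Bessel solution is the convolution of the datum with the radial heat kernel. -/
lemma radialHeat_eq_integral_radialKernel (hf : IntegrableOn (fun ξ => ξ * f ξ) (Ioi 0)) {τ : ℝ}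
    (hτ : 0 < τ) (r : ℝ) :
    radialHeat f τ r = ∫ ξ in Ioi (0 : ℝ), radialKernel τ r ξ * (ξ * f ξ) := by
  rw [radialHeat_eq_integral_prod hf hτ, integral_prod_symm _ (integrable_heat_prod hf hτ r)]
  congr 1; ext ξ
  rw [← integral_exp_mul_besselJ0_mul_besselJ0 hτ, ← integral_mul_const]
  congr 1; ext l
  ring

lemma continuous_besselI0 : Continuous besselI0 := by
  have h : Continuous besselSeries := by
    rw [continuous_iff_continuousAt]
    intro x
    have hx : x ∈ Ioo (-(|x| + 1)) (|x| + 1) :=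
      ⟨by linarith [neg_abs_le x], by linarith [le_abs_self x]⟩
    refine (continuousOn_tsum (u := fun k : ℕ => (|x| + 1) ^ k / (k.factorial : ℝ))
      (s := Ioo (-(|x| + 1)) (|x| + 1)) (fun k => by fun_prop)
      (Real.summable_pow_div_factorial _) fun k y hy => ?_).continuousAt (Ioo_mem_nhds hx.1 hx.2)
    have h1 : (1 : ℝ) ≤ k.factorial := by exact_mod_cast k.factorial_pos
    rw [norm_div, norm_pow, Real.norm_of_nonneg (by positivity : (0 : ℝ) ≤ (k.factorial : ℝ) ^ 2)]
    refine div_le_div₀ (by positivity) ?_ (by positivity) (by nlinarith)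
    gcongr
    exact (abs_lt.mpr hy).le
  rw [funext besselI0_eq_besselSeries]
  fun_prop

lemma continuous_radialKernel (τ ρ : ℝ) : Continuous (radialKernel τ ρ) := by
  have := continuous_besselI0
  unfold radialKernel
  fun_prop

lemma radialKernel_le_inv {τ ρ ξ : ℝ} (hτ : 0 < τ) (hρ : 0 ≤ ρ) (hξ : 0 ≤ ξ) :
    radialKernel τ ρ ξ ≤ 1 / (2 * τ) := by
  refine (radialKernel_le hτ hρ hξ).trans (mul_le_of_le_one_right (by positivity) ?_)
  rw [exp_le_one_iff, neg_div]
  exact neg_nonpos.mpr (by positivity)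

lemma integrableOn_radialKernel_mul (hf : IntegrableOn (fun ξ => ξ * f ξ) (Ioi 0)) {τ ρ : ℝ}
    (hτ : 0 < τ) (hρ : 0 ≤ ρ) :
    IntegrableOn (fun ξ => radialKernel τ ρ ξ * (ξ * f ξ)) (Ioi 0) := by
  refine Integrable.bdd_mul (c := 1 / (2 * τ)) hf
    (continuous_radialKernel τ ρ).aestronglyMeasurable ?_
  filter_upwards [ae_restrict_mem measurableSet_Ioi] with ξ hξ
  rw [Real.norm_of_nonneg (radialKernel_nonneg hτ ρ ξ)]
  exact radialKernel_le_inv hτ hρ (le_of_lt hξ)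

lemma integrableOn_radialKernel {τ : ℝ} (hτ : 0 < τ) (ρ : ℝ) :
    IntegrableOn (fun ξ => radialKernel τ ρ ξ * ξ) (Ioi 0) :=
  -- The Bochner integral of a non-integrable function is 0, so the value 1 forces integrability.
  Integrable.of_integral_ne_zero (by rw [integral_radialKernel hτ ρ]; exact one_ne_zero)

/-- The Gaussian exponent is split into halves: one yields the small factor in δ, the other, since
8τ ≤ 1, is at most ρ² - ξ²/2. This decay in ξ makes the constant f(r) integrable over the far
region. -/
lemma radialKernel_mul_le_of_far {τ ρ ξ δ : ℝ} (hτ : 0 < τ) (hτ1 : τ ≤ 1 / 8) (hρ : 0 ≤ ρ)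
    (hξ : 0 ≤ ξ) (hδ : 0 ≤ δ) (hfar : δ ≤ |ξ - ρ|) :
    radialKernel τ ρ ξ ≤ 1 / (2 * τ) * exp (-δ ^ 2 / (8 * τ)) *
      (exp (ρ ^ 2) * exp (-ξ ^ 2 * (1 / 2))) := by
  refine (radialKernel_le hτ hρ hξ).trans ?_
  rw [mul_assoc, ← exp_add, ← exp_add]
  refine mul_le_mul_of_nonneg_left (exp_le_exp.mpr ?_) (by positivity)
  have h1 : δ ^ 2 ≤ (ξ - ρ) ^ 2 := by
    rw [← sq_abs (ξ - ρ)]; exact pow_le_pow_left₀ hδ hfar 2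
  have h2 : -(ξ - ρ) ^ 2 / (4 * τ) = -(ξ - ρ) ^ 2 / (8 * τ) + -(ξ - ρ) ^ 2 / (8 * τ) := by
    field_simp; ring
  have h3 : -(ξ - ρ) ^ 2 / (8 * τ) ≤ -δ ^ 2 / (8 * τ) := by gcongr
  have h4 : -(ξ - ρ) ^ 2 / (8 * τ) ≤ -(ξ - ρ) ^ 2 := by
    rw [div_le_iff₀ (by positivity)]
    nlinarith [sq_nonneg (ξ - ρ)]
  nlinarith [sq_nonneg (ξ - 2 * ρ)]

lemma radialKernel_le_of_far {τ ρ ξ δ : ℝ} (hτ : 0 < τ) (hρ : 0 ≤ ρ)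
    (hξ : 0 ≤ ξ) (hδ : 0 ≤ δ) (hfar : δ ≤ |ξ - ρ|) :
    radialKernel τ ρ ξ ≤ 1 / (2 * τ) * exp (-δ ^ 2 / (8 * τ)) := by
  refine (radialKernel_le hτ hρ hξ).trans ?_
  refine mul_le_mul_of_nonneg_left (exp_le_exp.mpr ?_) (by positivity)
  have h1 : δ ^ 2 ≤ (ξ - ρ) ^ 2 := by
    rw [← sq_abs (ξ - ρ)]; exact pow_le_pow_left₀ hδ hfar 2
  rw [div_le_div_iff₀ (by positivity) (by positivity)]
  nlinarith [mul_le_mul_of_nonneg_right h1 hτ.le, mul_nonneg (sq_nonneg δ) hτ.le]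

lemma tendsto_far_coefficient {δ : ℝ} (hδ : 0 < δ) :
    Tendsto (fun τ : ℝ => 1 / (2 * τ) * exp (-δ ^ 2 / (8 * τ))) (𝓝[>] 0) (𝓝 0) := by
  have h := (tendsto_pow_mul_exp_neg_atTop_nhds_zero 1).comp
    (tendsto_inv_nhdsGT_zero.const_mul_atTop (by positivity : 0 < δ ^ 2 / 8))
  have h' := h.const_mul (4 / δ ^ 2)
  rw [mul_zero] at h'
  refine h'.congr fun τ => ?_
  simp only [Function.comp_apply, pow_one]
  rw [show -(δ ^ 2 / 8 * τ⁻¹) = -δ ^ 2 / (8 * τ) by rw [neg_div, div_mul_eq_div_div]; ring,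
    ← mul_assoc]
  congr 1
  rw [one_div, mul_inv]
  field_simp; norm_num

/-- The Fourier-Bessel solution attains its datum at every point of continuity. -/
lemma tendsto_radialHeat_initial (hf : IntegrableOn (fun ξ => ξ * f ξ) (Ioi 0)) {r : ℝ}
    (hc : ContinuousWithinAt f (Ici 0) r) :
    Tendsto (fun p : ℝ × ℝ => radialHeat f p.1 p.2) (𝓝[>] 0 ×ˢ 𝓝[Ici 0] r) (𝓝 (f r)) := by
  rw [Metric.tendsto_nhds]
  intro ε hε
  obtain ⟨η, hη, hfη⟩ := Metric.continuousWithinAt_iff.mp hc (ε / 2) (half_pos hε)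
  -- Half of η, so that |ξ - ρ| < δ and |ρ - r| < δ together give |ξ - r| < η.
  set δ := η / 2 with hδdef
  have hδ : 0 < δ := half_pos hη
  -- A majorant independent of τ and ρ for the far region: the first summand handles f, the second
  -- the constant f(r).
  let G : ℝ → ℝ := fun ξ => |ξ * f ξ| +
    |f r| * exp ((r + δ) ^ 2) * (ξ ^ 1 * exp (-ξ ^ 2 * (1 / 2)))
  have hG : IntegrableOn G (Ioi 0) :=
    hf.abs.add ((integrableOn_pow_mul_exp_neg_sq 1 one_half_pos).const_mul _)
  have hlim := (tendsto_far_coefficient hδ).mul_const (∫ ξ in Ioi (0 : ℝ), G ξ)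
  rw [zero_mul] at hlim
  have e1 : ∀ᶠ p : ℝ × ℝ in 𝓝[>] 0 ×ˢ 𝓝[Ici 0] r,
      1 / (2 * p.1) * exp (-δ ^ 2 / (8 * p.1)) * (∫ ξ in Ioi (0 : ℝ), G ξ) < ε / 2 :=
    tendsto_fst.eventually (hlim.eventually (gt_mem_nhds (half_pos hε)))
  have e2 : ∀ᶠ p : ℝ × ℝ in 𝓝[>] 0 ×ˢ 𝓝[Ici 0] r, p.1 ∈ Ioo (0 : ℝ) (1 / 8) :=
    tendsto_fst.eventually (Ioo_mem_nhdsGT (by norm_num))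
  have e3 : ∀ᶠ p : ℝ × ℝ in 𝓝[>] 0 ×ˢ 𝓝[Ici 0] r, |p.2 - r| < δ :=
    tendsto_snd.eventually (nhdsWithin_le_nhds (Metric.ball_mem_nhds r hδ))
  have e4 : ∀ᶠ p : ℝ × ℝ in 𝓝[>] 0 ×ˢ 𝓝[Ici 0] r, 0 ≤ p.2 :=
    tendsto_snd.eventually self_mem_nhdsWithin
  filter_upwards [e1, e2, e3, e4] with ⟨τ, ρ⟩ h1 h2 h3 h4
  simp only at h1 h2 h3 h4 ⊢
  obtain ⟨hτ, hτ1⟩ := h2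
  have hK := integrableOn_radialKernel hτ ρ
  have hKf := integrableOn_radialKernel_mul hf hτ h4
  have hdiff : radialHeat f τ ρ - f r =
      ∫ ξ in Ioi (0 : ℝ), (radialKernel τ ρ ξ * (ξ * f ξ) - radialKernel τ ρ ξ * ξ * f r) := by
    rw [integral_sub hKf (hK.mul_const _), ← radialHeat_eq_integral_radialKernel hf hτ,
      integral_mul_const, integral_radialKernel hτ, one_mul]
  set C := 1 / (2 * τ) * exp (-δ ^ 2 / (8 * τ)) with hC
  have hCpos : 0 ≤ C := by positivity
  have hGpos : ∀ ξ : ℝ, 0 < ξ → 0 ≤ G ξ := fun ξ hξ => by positivity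
  have hpt : ∀ ξ ∈ Ioi (0 : ℝ),
      ‖radialKernel τ ρ ξ * (ξ * f ξ) - radialKernel τ ρ ξ * ξ * f r‖ ≤
        ε / 2 * (radialKernel τ ρ ξ * ξ) + C * G ξ := by
    intro ξ hξ
    have hξ' : (0 : ℝ) < ξ := hξ
    have hK0 := radialKernel_nonneg hτ ρ ξ
    by_cases hfar : δ ≤ |ξ - ρ|
    · have b1 := radialKernel_le_of_far hτ h4 hξ'.le hδ.le hfar
      have b2 := radialKernel_mul_le_of_far hτ hτ1.le h4 hξ'.le hδ.le hfar
      rw [← hC] at b1 b2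
      have hρ : exp (ρ ^ 2) ≤ exp ((r + δ) ^ 2) := by
        refine exp_le_exp.mpr (pow_le_pow_left₀ h4 ?_ 2)
        linarith [(abs_lt.mp h3).2]
      have b3 : radialKernel τ ρ ξ ≤ C * (exp ((r + δ) ^ 2) * exp (-ξ ^ 2 * (1 / 2))) :=
        b2.trans (by gcongr)
      calc ‖radialKernel τ ρ ξ * (ξ * f ξ) - radialKernel τ ρ ξ * ξ * f r‖
          ≤ ‖radialKernel τ ρ ξ * (ξ * f ξ)‖ + ‖radialKernel τ ρ ξ * ξ * f r‖ := norm_sub_le _ _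
        _ = radialKernel τ ρ ξ * |ξ * f ξ| + radialKernel τ ρ ξ * (ξ * |f r|) := by
          simp only [norm_mul, Real.norm_eq_abs, abs_of_nonneg hK0, abs_of_pos hξ', abs_mul]
          ring
        _ ≤ C * |ξ * f ξ| +
            C * (exp ((r + δ) ^ 2) * exp (-ξ ^ 2 * (1 / 2))) * (ξ * |f r|) := by gcongr
        _ = C * G ξ := by simp only [G, pow_one]; ring
        _ ≤ _ := le_add_of_nonneg_left (by positivity)
    · have hclose : dist ξ r < η := by
        have := abs_sub_le ξ ρ r
        rw [Real.dist_eq]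
        push Not at hfar
        linarith
      have hfd := hfη (x := ξ) hξ'.le hclose
      rw [Real.dist_eq] at hfd
      calc ‖radialKernel τ ρ ξ * (ξ * f ξ) - radialKernel τ ρ ξ * ξ * f r‖
          = radialKernel τ ρ ξ * ξ * |f ξ - f r| := by
            rw [show radialKernel τ ρ ξ * (ξ * f ξ) - radialKernel τ ρ ξ * ξ * f r =
              radialKernel τ ρ ξ * ξ * (f ξ - f r) by ring, norm_mul,
              Real.norm_of_nonneg (by positivity), Real.norm_eq_abs]
        _ ≤ radialKernel τ ρ ξ * ξ * (ε / 2) := by gcongr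
        _ = ε / 2 * (radialKernel τ ρ ξ * ξ) := by ring
        _ ≤ _ := le_add_of_nonneg_right (mul_nonneg hCpos (hGpos ξ hξ'))
  rw [Real.dist_eq, hdiff, ← Real.norm_eq_abs]
  refine (norm_integral_le_of_norm_le ((hK.const_mul (ε / 2)).add (hG.const_mul C))
    ((ae_restrict_mem measurableSet_Ioi).mono hpt)).trans_lt ?_
  rw [integral_add' (hK.const_mul (ε / 2)) (hG.const_mul C), integral_const_mul,
    integral_const_mul, integral_radialKernel hτ]
  linarith

end

/-! ### The Laguerre expansion of the solution -/

/-- The strict inequality at w persists slightly to its right. The case w = 0 serves the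
coefficients, w = β/(τ+β) the expansion. -/
lemma exists_between_of_div_lt {β c w : ℝ} (hw0 : 0 ≤ w) (hw1 : w < 1)
    (h : w / (1 + w) / (4 * β) < c) : ∃ q, w < q ∧ q < 1 ∧ q / (1 + q) / (4 * β) ≤ c := by
  have hne : 1 + w ≠ 0 := by positivity
  have hcont : ContinuousAt (fun q : ℝ => q / (1 + q) / (4 * β)) w := by
    fun_prop (disch := assumption)
  have h1 : ∀ᶠ q in 𝓝[>] w, q / (1 + q) / (4 * β) < c :=
    nhdsWithin_le_nhds (hcont.eventually (gt_mem_nhds h))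
  obtain ⟨q, hq, hq'⟩ := (h1.and (Ioo_mem_nhdsGT hw1)).exists
  exact ⟨q, hq'.1, hq'.2, hq.le⟩

section
variable {f : ℝ → ℝ} {β c : ℝ}

lemma integrableOn_mul_of_weighted (hc : 0 < c)
    (hf : IntegrableOn (fun ξ : ℝ => ξ * exp (c * ξ ^ 2) * f ξ) (Ioi 0)) :
    IntegrableOn (fun ξ => ξ * f ξ) (Ioi 0) := by
  have h : IntegrableOn (fun ξ : ℝ => exp (-(c * ξ ^ 2)) * (ξ * exp (c * ξ ^ 2) * f ξ)) (Ioi 0) :=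
    Integrable.bdd_mul (c := 1) hf (Continuous.aestronglyMeasurable (by fun_prop))
      (Eventually.of_forall fun ξ => by
        rw [Real.norm_of_nonneg (exp_pos _).le, exp_le_one_iff]
        exact neg_nonpos.mpr (by positivity))
  refine h.congr_fun (fun ξ _ => ?_) measurableSet_Ioi
  simp only
  rw [exp_neg]
  have := (exp_pos (c * ξ ^ 2)).ne'
  field_simp

lemma norm_laguerre_mul_le {q : ℝ} (hβ : 0 < β) (hq0 : 0 < q) (hq1 : q < 1)
    (hqc : q / (1 + q) / (4 * β) ≤ c) (j : ℕ) (ξ : ℝ) :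
    ‖laguerre j (ξ ^ 2 / (4 * β)) * (ξ * f ξ)‖ ≤
      (1 / q) ^ j / (1 - q) * ‖ξ * exp (c * ξ ^ 2) * f ξ‖ := by
  have h := abs_laguerre_mul_pow_le j (y := ξ ^ 2 / (4 * β)) (by positivity) hq0 hq1
  have h1q : 0 < 1 - q := by linarith
  have he : exp (ξ ^ 2 / (4 * β) * (q / (1 + q))) ≤ exp (c * ξ ^ 2) := by
    refine exp_le_exp.mpr ?_
    rw [show ξ ^ 2 / (4 * β) * (q / (1 + q)) = q / (1 + q) / (4 * β) * ξ ^ 2 by ring]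
    gcongr
  have h2 : |laguerre j (ξ ^ 2 / (4 * β))| ≤ (1 / q) ^ j / (1 - q) * exp (c * ξ ^ 2) := by
    rw [← le_div_iff₀ (by positivity)] at h
    calc |laguerre j (ξ ^ 2 / (4 * β))|
        ≤ exp (ξ ^ 2 / (4 * β) * (q / (1 + q))) / (1 - q) / q ^ j := h
      _ ≤ exp (c * ξ ^ 2) / (1 - q) / q ^ j := by gcongr
      _ = (1 / q) ^ j / (1 - q) * exp (c * ξ ^ 2) := by rw [one_div, inv_pow]; ring
  rw [norm_mul, show ξ * exp (c * ξ ^ 2) * f ξ = exp (c * ξ ^ 2) * (ξ * f ξ) by ring,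
    norm_mul (exp _), Real.norm_of_nonneg (exp_pos (c * ξ ^ 2)).le, ← mul_assoc]
  gcongr
  exact h2

lemma integrableOn_laguerre_mul (hβ : 0 < β) (hc : 0 < c)
    (hf : IntegrableOn (fun ξ : ℝ => ξ * exp (c * ξ ^ 2) * f ξ) (Ioi 0)) (j : ℕ) :
    IntegrableOn (fun ξ => laguerre j (ξ ^ 2 / (4 * β)) * (ξ * f ξ)) (Ioi 0) := by
  obtain ⟨q, hq0, hq1, hqc⟩ := exists_between_of_div_lt (w := 0) le_rfl one_pos
    (by simpa using hc)
  refine Integrable.mono' (hf.norm.const_mul ((1 / q) ^ j / (1 - q))) ?_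
    (Eventually.of_forall (norm_laguerre_mul_le hβ hq0 hq1 hqc j))
  exact ((continuous_laguerre j).comp (by fun_prop)).aestronglyMeasurable.mul
    (integrableOn_mul_of_weighted hc hf).aestronglyMeasurable

lemma integral_norm_laguerre_mul_le {q : ℝ} (hβ : 0 < β) (hc : 0 < c)
    (hf : IntegrableOn (fun ξ : ℝ => ξ * exp (c * ξ ^ 2) * f ξ) (Ioi 0))
    (hq0 : 0 < q) (hq1 : q < 1) (hqc : q / (1 + q) / (4 * β) ≤ c) (j : ℕ) :
    ∫ ξ in Ioi (0 : ℝ), ‖laguerre j (ξ ^ 2 / (4 * β)) * (ξ * f ξ)‖ ≤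
      (1 / q) ^ j / (1 - q) * ∫ ξ in Ioi (0 : ℝ), ‖ξ * exp (c * ξ ^ 2) * f ξ‖ := by
  rw [← integral_const_mul]
  exact integral_mono (integrableOn_laguerre_mul hβ hc hf j).norm (hf.norm.const_mul _)
    (norm_laguerre_mul_le hβ hq0 hq1 hqc j)

lemma radialW_div_eq_laguerre (hβ : 0 < β) (j : ℕ) (ξ : ℝ) :
    radialW j (ξ / (2 * √β)) = (-1) ^ j * ((2 * j).factorial : ℝ) / (j.factorial : ℝ) *
      laguerre j (ξ ^ 2 / (4 * β)) := by
  rw [radialW_eq_laguerre, div_pow, mul_pow, sq_sqrt hβ.le]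
  norm_num

/-- Expansion of the Fourier-Bessel solution in products of Laguerre functions. -/
lemma hasSum_radialHeat_laguerre (hβ : 0 < β) (hc : 0 < c)
    (hf : IntegrableOn (fun ξ : ℝ => ξ * exp (c * ξ ^ 2) * f ξ) (Ioi 0)) {τ : ℝ} (hτ : 0 < τ)
    (hcτ : 1 / (4 * (τ + 2 * β)) < c) (r : ℝ) :
    HasSum (fun j : ℕ => ((j.factorial : ℝ) / (2 * (τ + β) ^ (j + 1)) *
        (exp (-(r ^ 2 / (4 * (τ + β)))) * laguerre j (r ^ 2 / (4 * (τ + β))))) *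
        (β ^ j / (j.factorial : ℝ) *
          ∫ ξ in Ioi (0 : ℝ), laguerre j (ξ ^ 2 / (4 * β)) * (ξ * f ξ)))
      (radialHeat f τ r) := by
  have ha : 0 < τ + β := by positivity
  have hf0 := integrableOn_mul_of_weighted hc hf
  have hJc : Continuous fun l => besselJ0 (l * r) := continuous_besselJ0.comp (by fun_prop)
  have hJb : ∀ l, |besselJ0 (l * r)| ≤ 1 := fun l => abs_besselJ0_le_one _
  -- The factor e^{-l²τ} is traded for e^{-l²(τ+β)}; the surplus e^{l²β} goes into the Laguerre
  -- series with s = l²β, y = ξ²/(4β), for which sy = (lξ)²/4.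
  let A : ℕ → ℝ → ℝ := fun j l => l ^ (2 * j + 1) * exp (-l ^ 2 * (τ + β)) * besselJ0 (l * r)
  let B : ℕ → ℝ → ℝ := fun j ξ =>
    β ^ j / (j.factorial : ℝ) * (laguerre j (ξ ^ 2 / (4 * β)) * (ξ * f ξ))
  have hA : ∀ j, Integrable (A j) (volume.restrict (Ioi 0)) := fun j =>
    integrableOn_pow_mul_exp_neg_sq_mul _ ha hJc hJb
  have hB : ∀ j, Integrable (B j) (volume.restrict (Ioi 0)) := fun j =>
    (integrableOn_laguerre_mul hβ hc hf j).const_mul _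
  -- For this w the quotient w/(1+w)/(4β) equals 1/(4(τ+2β)), which is where the threshold on c
  -- arises.
  obtain ⟨q, hwq, hq1, hqc⟩ := exists_between_of_div_lt (w := β / (τ + β)) (c := c)
    (by positivity) ((div_lt_one ha).mpr (by linarith))
    (by convert! hcτ using 1; field_simp; ring)
  have hq0 : 0 < q := lt_of_le_of_lt (by positivity) hwq
  have h1q : 0 < 1 - q := by linarith
  set D := ∫ ξ in Ioi (0 : ℝ), ‖ξ * exp (c * ξ ^ 2) * f ξ‖ with hD
  have hD0 : 0 ≤ D := integral_nonneg fun _ => norm_nonneg _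
  have key := hasSum_integral_of_summable_integral_norm
    (μ := (volume.restrict (Ioi (0 : ℝ))).prod (volume.restrict (Ioi (0 : ℝ))))
    (F := fun (j : ℕ) p => A j p.1 * B j p.2) (fun j => (hA j).mul_prod (hB j)) ?_
  · have hval : ∀ p : ℝ × ℝ, ∑' j, A j p.1 * B j p.2 = p.1 * exp (-p.1 ^ 2 * τ) * (p.2 * f p.2) *
        (besselJ0 (p.1 * r) * besselJ0 (p.1 * p.2)) := by
      rintro ⟨l, ξ⟩
      have h := (hasSum_laguerre_div_factorial (l ^ 2 * β) (ξ ^ 2 / (4 * β))).mul_left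
        (l * exp (-l ^ 2 * (τ + β)) * besselJ0 (l * r) * (ξ * f ξ))
      refine HasSum.tsum_eq ?_
      convert! h using 1
      · funext j
        simp only [A, B]
        rw [mul_pow, pow_succ, pow_mul]
        ring
      · simp only
        rw [besselJ0_eq_besselSeries (l * ξ), show l ^ 2 * β * (ξ ^ 2 / (4 * β)) =
          (l * ξ) ^ 2 / 4 by field_simp, show -l ^ 2 * τ = -l ^ 2 * (τ + β) + l ^ 2 * β by ring,
          exp_add]
        ring
    simp only [hval, integral_prod_mul] at key
    rw [← radialHeat_eq_integral_prod hf0 hτ] at key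
    convert! key using 1
    funext j
    simp only [A, B]
    rw [integral_pow_mul_exp_mul_besselJ0 j ha, integral_const_mul]
  -- The factorials of the two factors cancel, leaving a geometric series whose ratio is below 1
  -- because q > β/(τ+β).
  · have hgeo : Summable fun j : ℕ => D / (2 * (τ + β) * (1 - q)) * (β / (τ + β) / q) ^ j :=
      (summable_geometric_of_lt_one (by positivity) ((div_lt_one hq0).mpr hwq)).mul_left _
    refine Summable.of_nonneg_of_le (fun j => integral_nonneg fun _ => norm_nonneg _)
      (fun j => ?_) hgeo
    simp only [norm_mul (A _ _)]
    rw [integral_prod_mul (fun l => ‖A j l‖) (fun ξ => ‖B j ξ‖)]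
    have h1 : ∫ l in Ioi (0 : ℝ), ‖A j l‖ ≤ (j.factorial : ℝ) / (2 * (τ + β) ^ (j + 1)) :=
      integral_abs_pow_mul_exp_neg_sq_mul_le j ha hJc hJb
    have h2 : ∫ ξ in Ioi (0 : ℝ), ‖B j ξ‖ ≤
        β ^ j / (j.factorial : ℝ) * ((1 / q) ^ j / (1 - q) * D) := by
      simp only [B, norm_mul (β ^ j / (j.factorial : ℝ)), integral_const_mul]
      rw [Real.norm_of_nonneg (by positivity)]
      exact mul_le_mul_of_nonneg_left
        (integral_norm_laguerre_mul_le hβ hc hf hq0 hq1 hqc j) (by positivity)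
    refine (mul_le_mul h1 h2 (integral_nonneg fun _ => norm_nonneg _) (by positivity)).trans_eq ?_
    have hj : (j.factorial : ℝ) ≠ 0 := by positivity
    rw [div_pow, div_pow, div_pow, one_pow, pow_succ]
    field_simp

end

theorem mainTheorem7 (f : ℝ → ℝ) (β c : ℝ) (hβ : 0 < β) (hc : 0 < c)
    (hf : IntegrableOn (fun ξ : ℝ => ξ * exp (c * ξ ^ 2) * f ξ) (Ioi 0)) :
    -- the generating function of the polynomials
    (∀ t z : ℝ, HasSum (fun j : ℕ => t ^ (2 * j) / ((2 * j).factorial : ℝ) * radialW j z)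
      (exp (-t ^ 2) * besselI0 (2 * t * z))) ∧
    -- each `radialW j` is a polynomial
    (∀ j : ℕ, ∃ P : Polynomial ℝ, ∀ z : ℝ, radialW j z = P.eval z) ∧
    -- `radialHeat f` is the solution of the radial Cauchy problem
    IsRadialHeatSolution f (radialHeat f) ∧
    -- the coefficients converge absolutely
    (∀ j : ℕ, IntegrableOn (fun ξ : ℝ => radialW j (ξ / (2 * √β)) * (ξ * f ξ)) (Ioi 0)) ∧
    -- the expansion
    (∀ τ > 0, 1 / (4 * (τ + 2 * β)) < c → ∀ r ≥ 0,
      HasSum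
        (fun j : ℕ => exp (-r ^ 2 / (4 * (τ + β))) / (2 * (τ + β)) *
          (1 / (τ + β) ^ j * radialW j (r / (2 * √(τ + β))) *
            ((j.factorial : ℝ) ^ 2 * β ^ j / ((2 * j).factorial : ℝ) ^ 2) * radialCoeff β f j))
        (radialHeat f τ r)) := by
  have hf0 := integrableOn_mul_of_weighted hc hf
  refine ⟨hasSum_radialW, exists_polynomial_radialW, ?_, fun j => ?_, fun τ hτ hcτ r hr => ?_⟩
  · exact
      { continuousOn := fun p hp => (continuousAt_radialHeat hf0 hp.1).continuousWithinAt
        differentiable_time := fun τ hτ r _ =>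
          (hasDerivAt_radialHeat_time hf0 hτ r).differentiableAt
        differentiable_radius := fun τ hτ r _ =>
          (hasDerivAt_radialHeat_radius hf0 hτ r).differentiableAt
        differentiable_radius_two := fun τ hτ r _ =>
          (hasDerivAt_deriv_radialHeat hf0 hτ r).differentiableAt
        heat_equation := fun τ hτ r hr => radialHeat_heat_equation hf0 hτ hr
        regular_at_pole := fun τ hτ => (radialHeat_regular_at_pole hf0 hτ).hasDerivWithinAt
        -- Convergence holds along all ρ ≥ 0; `𝓝[≥] r` only approaches from ρ ≥ r and is a smaller
        -- filter.
        initial_value := fun r hr hfr => (tendsto_radialHeat_initial hf0 hfr).mono_left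
          (Filter.prod_mono le_rfl (nhdsWithin_mono r (Ici_subset_Ici.mpr hr))) }
  · simp only [radialW_div_eq_laguerre hβ, mul_assoc]
    exact (integrableOn_laguerre_mul hβ hc hf j).const_mul _
  · convert! hasSum_radialHeat_laguerre hβ hc hf hτ hcτ r using 1
    funext j
    have ha : 0 < τ + β := by positivity
    have h1 : (j.factorial : ℝ) ≠ 0 := by positivity
    have h2 : ((2 * j).factorial : ℝ) ≠ 0 := by positivity
    simp only [radialCoeff, radialW_div_eq_laguerre hβ, mul_assoc, integral_const_mul]
    rw [radialW_div_eq_laguerre ha, neg_div, pow_succ]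
    -- Each of the two `radialW` factors contributes (-1)^j (2j)!/j!: the signs square to 1 and the
    -- factorials cancel the stated ratio.
    have h3 : ((-1 : ℝ) ^ j) * (-1) ^ j = 1 := by rw [← mul_pow]; norm_num
    generalize (∫ ξ in Ioi (0 : ℝ), laguerre j (ξ ^ 2 / (4 * β)) * (ξ * f ξ)) = y
    field_simp
    linear_combination (laguerre j (r ^ 2 / (4 * (τ + β))) * y * (τ + β) ^ (j + 1)) * h3
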